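/- Let $d\ge 2$ and $\beta\ge 1$ be integers, let $\sigma$ be the surface measure on the unit sphere $S^{d-1}\subset\mathbb{R}^d$, and put $|S^{d-1}|=\sigma(S^{d-1})$. Let $U$ be uniformly distributed on $S^{d-1}$, and let $$\rho_\beta(b,c)=\mathbb{E}\big[(b^\top U)^\beta (c^\top U)^\beta\big]-\psi_d(\beta)^2,\qquad b,c\in S^{d-1},$$ where $\psi_d(\beta)=\mathbb{E}(b^\top U)^\beta$, which does not depend on $b$, equals $\frac{\Gamma((\beta+1)/2)\,\Gamma(d/2)}{\sqrt{\pi}\,\Gamma((\beta+d)/2)}$ if $\beta$ is even and $0$ if $\beta$ is odd. Let $Z_\beta=(Z_\beta(b))_{b\in S^{d-1}}$ denote a centred Gaussian process with continuous sample paths and covariance kernel $\rho_\beta$ (its law is the weak limit in $C(S^{d-1},\mathbb{R})$ of $b\mapsto \sqrt{n}\big(\frac1n\sum_{j=1}^n (b^\top U_j)^\beta-\psi_d(\beta)\big)$ for $U_1,U_2,\dots$ iid uniform on $S^{d-1}$). For $k\ge 0$ let $\mathcal{H}_k$ be the space of spherical harmonics of order $k$, that is, of restrictions to $S^{d-1}$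 of homogeneous harmonic polynomials of degree $k$ in $d$ variables, and let $\nu_d(k)=\dim\mathcal{H}_k$. Let $P_k^d$ be the $d$-dimensional Legendre polynomial of order $k$, that is, the unique polynomial such that $\sum_{i=1}^{\nu_d(k)}\phi_i(u)\phi_i(v)=\frac{\nu_d(k)}{|S^{d-1}|}P_k^d(u^\top v)$ for all $u,v\in S^{d-1}$ and every basis $\phi_1,\dots,\phi_{\nu_d(k)}$ of $\mathcal{H}_k$ that is orthonormal with respect to $\sigma$. Let $c_{0,d}(\beta),\dots,c_{\beta,d}(\beta)$ be the unique real numbers with $t^\beta=\sum_{j=0}^\beta c_{j,d}(\beta)P_j^d(t)$ for $t\in[-1,1]$, and let $\lambda_k=\big(c_{k,d}(\beta)/\nu_d(k)\big)^2$ for $1\le k\le\beta$. For every $1\le k\le \beta$ with $k\equiv\beta \pmod 2$ let $\phi_{k,1},\dots,\phi_{k,\nu_d(k)}\in\mathcal{H}_k$ be orthonormal with respect to $\sigma$. Then $Z_\beta$ can be represented as $$Z_\beta(b)=\sqrt{|S^{d-1}|}\sum_{\substack{1\le k\le\beta\\ k\equiv\beta\ (\mathrm{mod}\ 2)}}\sqrt{\lambda_k}\sum_{j=1}^{\nu_d(k)}\phi_{k,j}(b)\,N_{k,j},\qquad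 b\in S^{d-1},$$ with independent standard normal random variables $N_{k,j}$, in both of the following senses. 1. For every process $Z_\beta$ as above there are independent standard normal variables $N_{k,j}$ on the same probability space such that, almost surely, the identity holds for all $b\in S^{d-1}$ simultaneously. 2. For every array of independent standard normal variables $N_{k,j}$, on any probability space, the right-hand side is a centred Gaussian process with continuous sample paths and covariance kernel $\rho_\beta$, and it has the same law as every process $Z_\beta$ as above. -/

import Mathlib

open MeasureTheory ProbabilityTheory
open scoped RealInnerProductSpace

noncomputable section

namespace SphereProj

/-- The unit sphere `S^{d-1}` of `ℝ^d` with the Euclidean norm. -/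
abbrev Sph (d : ℕ) : Type := Metric.sphere (0 : EuclideanSpace ℝ (Fin d)) 1

/-- The spherical Lebesgue (surface) measure `σ` on `S^{d-1}`. -/
def surface (d : ℕ) : Measure (Sph d) :=
  (volume : Measure (EuclideanSpace ℝ (Fin d))).toSphere

/-- The total surface area `|S^{d-1}|`. -/
def area (d : ℕ) : ℝ := (surface d).real Set.univ

/-- The uniform distribution on `S^{d-1}`. -/
def uniformSphere (d : ℕ) : Measure (Sph d) :=
  (surface d Set.univ)⁻¹ • surface d

/-- The Laplacian `∑ i, ∂²/∂x_i²` on real polynomials in `d` variables. -/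
def laplacianPoly (d : ℕ) : MvPolynomial (Fin d) ℝ →ₗ[ℝ] MvPolynomial (Fin d) ℝ :=
  ∑ i : Fin d,
    (MvPolynomial.pderiv i : Derivation ℝ (MvPolynomial (Fin d) ℝ) _).toLinearMap ∘ₗ
      (MvPolynomial.pderiv i : Derivation ℝ (MvPolynomial (Fin d) ℝ) _).toLinearMap

/-- Restriction of a polynomial on `ℝ^d` to the sphere, as a continuous function. -/
def restrictSphere (d : ℕ) : MvPolynomial (Fin d) ℝ →ₗ[ℝ] C(Sph d, ℝ) where
  toFun p :=
    { toFun := fun x => MvPolynomial.eval (fun i => (x : EuclideanSpace ℝ (Fin d)) i) p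
      continuous_toFun := p.continuous_eval.comp (by fun_prop) }
  map_add' p q := by ext x; simp
  map_smul' a p := by ext x; simp

/-- The space `H_k(S^{d-1})` of spherical harmonics of order `k`: restrictions to the sphere of
homogeneous harmonic polynomials of degree `k`. -/
def harmonics (d k : ℕ) : Submodule ℝ C(Sph d, ℝ) :=
  (MvPolynomial.homogeneousSubmodule (Fin d) ℝ k ⊓ LinearMap.ker (laplacianPoly d)).map
    (restrictSphere d)

/-- `ν_d(k) = dim H_k(S^{d-1})`. -/
def dimH (d k : ℕ) : ℕ := Module.finrank ℝ (harmonics d k)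

/-- `φ_1, …, φ_{ν_d(k)}` are spherical harmonics of order `k`, orthonormal with respect to `σ`
(their number being the dimension, they form an orthonormal basis of `H_k(S^{d-1})`). -/
structure IsHarmonicONB (d k : ℕ) (φ : Fin (dimH d k) → C(Sph d, ℝ)) : Prop where
  mem : ∀ j, φ j ∈ harmonics d k
  orthonormal : ∀ i j, ∫ ω, φ i ω * φ j ω ∂(surface d) = if i = j then 1 else 0

/-- The property defining the `d`-dimensional Legendre polynomial of order `k`: for every
orthonormal basis `φ_1, …, φ_{ν_d(k)}` of `H_k(S^{d-1})`,
`∑ i, φ_i(u) φ_i(v) = (ν_d(k) / |S^{d-1}|) P(⟨u, v⟩)` on the sphere. -/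
def IsLegendre (d k : ℕ) (p : Polynomial ℝ) : Prop :=
  ∀ φ : Fin (dimH d k) → C(Sph d, ℝ), IsHarmonicONB d k φ → ∀ u v : Sph d,
    ∑ i, φ i u * φ i v =
      dimH d k / area d *
        p.eval ⟪(u : EuclideanSpace ℝ (Fin d)), (v : EuclideanSpace ℝ (Fin d))⟫

/-- The `d`-dimensional Legendre polynomial `P_k^d` (for `d ≥ 2` there is exactly one polynomial
with the defining property). -/
def legendreP (d k : ℕ) : Polynomial ℝ := Classical.epsilon (IsLegendre d k)

/-- `t^m = ∑_{j=0}^m c_j P_j^d(t)` on `[-1, 1]`. -/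
def IsPowerExpansion (d m : ℕ) (c : Fin (m + 1) → ℝ) : Prop :=
  ∀ t ∈ Set.Icc (-1 : ℝ) 1, t ^ m = ∑ j, c j * (legendreP d j).eval t

/-- The coefficient `c_{j,d}(m)` of `P_j^d` in the expansion of `t^m` in Legendre polynomials (for
`d ≥ 2` there is exactly one such expansion); it is `0` for `j > m`. -/
def legendreCoeff (d m j : ℕ) : ℝ :=
  if h : j < m + 1 then Classical.epsilon (IsPowerExpansion d m) ⟨j, h⟩ else 0

/-- `λ_k = (c_{k,d}(β) / ν_d(k))²` for `0 < k ≤ β`, and `λ_k = 0` otherwise. -/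
def eigenval (d β k : ℕ) : ℝ :=
  if 0 < k ∧ k ≤ β then (legendreCoeff d β k / dimH d k) ^ 2 else 0

/-- `ψ_d(β)`, the value of `E (bᵀU)^β` for `U` uniform on the sphere and any unit vector `b`. -/
def psi (d β : ℕ) : ℝ :=
  if Even β then
    Real.Gamma ((β + 1) / 2) * Real.Gamma (d / 2) /
      (Real.sqrt Real.pi * Real.Gamma ((β + d) / 2))
  else 0

/-- `η_β(b, c) = E (bᵀU)^β (cᵀU)^β` for `U` uniform on the sphere. -/
def eta (d β : ℕ) (b c : Sph d) : ℝ :=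
  ∫ ω, ⟪(b : EuclideanSpace ℝ (Fin d)), (ω : EuclideanSpace ℝ (Fin d))⟫ ^ β *
    ⟪(c : EuclideanSpace ℝ (Fin d)), (ω : EuclideanSpace ℝ (Fin d))⟫ ^ β ∂(uniformSphere d)

/-- The covariance kernel `ρ_β(b, c) = η_β(b, c) - ψ_d(β)²`. -/
def rho (d β : ℕ) (b c : Sph d) : ℝ := eta d β b c - psi d β ^ 2

/-- `Z` is (a version of) the limiting process `Z_β`: a centred Gaussian process indexed by the
sphere, with continuous sample paths and covariance kernel `ρ_β`. -/
structure IsLimitProcess (d β : ℕ) {Ω : Type*} [MeasurableSpace Ω]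
    (Z : Sph d → Ω → ℝ) (P : Measure Ω) : Prop where
  measurable : ∀ b, Measurable (Z b)
  gaussian : IsGaussianProcess Z P
  centred : ∀ b, ∫ ω, Z b ω ∂P = 0
  covariance : ∀ b c, cov[Z b, Z c; P] = rho d β b c
  continuous_paths : ∀ ω, Continuous fun b => Z b ω

/-- The orders `1 ≤ k ≤ β` of the same parity as `β`. -/
def orders (β : ℕ) : Finset ℕ := (Finset.Icc 1 β).filter fun k => k % 2 = β % 2

/-- Index set of the array `N_{k,j}`, `k` in `orders β` and `j = 1, …, ν_d(k)`. -/
abbrev ArrayIndex (d β : ℕ) : Type := (k : orders β) × Fin (dimH d k)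

/-- `N` is an array of independent standard normal random variables. -/
structure IsStdNormalArray {ι Ω : Type*} [MeasurableSpace Ω] (N : ι → Ω → ℝ)
    (P : Measure Ω) : Prop where
  measurable : ∀ i, Measurable (N i)
  law : ∀ i, P.map (N i) = gaussianReal 0 1
  indep : iIndepFun N P

/-- `√|S^{d-1}| ∑_{k} √λ_k ∑_{j=1}^{ν_d(k)} φ_{k,j}(b) x_{k,j}`, the outer sum being over
`1 ≤ k ≤ β` of the same parity as `β`. -/
def expansion (d β : ℕ) (φ : (k : ℕ) → Fin (dimH d k) → C(Sph d, ℝ))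
    (x : ArrayIndex d β → ℝ) (b : Sph d) : ℝ :=
  Real.sqrt (area d) *
    ∑ k : orders β, Real.sqrt (eigenval d β k) * ∑ j : Fin (dimH d k), φ k j b * x ⟨k, j⟩

end SphereProj

end

open SphereProj

/-!
The covariance kernel `ρ_β` has finite rank and factors as `ρ_β(b, c) = ∑ i, f_i(b) f_i(c)`, where
`f_{k,j} = √|S^{d-1}| √λ_k φ_{k,j}` are finitely many linearly independent continuous functions
(`rho_eq_sum_loading`, `loading_linearIndependent`). The theorem follows from this by a Gaussian
argument that involves only finitely many values of the process.

*Factorization.* Everything rests on the functional `p ↦ ∫ p(x) exp(-‖x‖² / 2) dx` on polynomials.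
It satisfies the integration by parts rule `X_i p ↦ ∂_i p` (`gaussInt_X_mul`), and on homogeneous
polynomials it is a positive multiple of integration over the sphere (`gaussInt_eq_radial_mul`).
Integration by parts alone yields that spherical harmonics of different orders are orthogonal
(`gaussInt_mul_eq_zero`) and that, for a unit vector `a` and `f ∈ H_k`,
`∫ ⟨a, ω⟩ ^ m f(ω) dσ(ω) = μ_{m,k} f(a)`, where `μ_{m,k} > 0` if `k ≤ m` and `k ≡ m mod 2`, and
`μ_{m,k} = 0` if the parities differ (`sphInt_zonalPow_mul`). Since `⟨a, ·⟩ ^ m` is a sum of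
spherical harmonics of orders at most `m` (`zonalPow_mem_iSup`), it follows that
`⟨a, v⟩ ^ m = ∑ k ≤ m, μ_{m,k} K_k(a, v)`, where `K_k` is the reproducing kernel of `H_k`
(`inner_pow_eq_sum`). As `μ_{k,k} ≠ 0`, this triangular system shows that `K_k(u, v)` is a
polynomial in `⟨u, v⟩`. Hence the Legendre polynomials and the power expansions exist, and the Legendre
coefficients satisfy `c_k / ν_k = μ_{m,k} / |S^{d-1}|` (`legendreCoeff_div_dimH`). The term `k = 0`
of the resulting expansion of `η_β` is `ψ_d(β)²` (`zonalMoment_zero_right`).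

*Gaussian argument.* By linear independence there are finitely many points `x` and weights `A_i(x)`
with `∑ x, A_i(x) f_j(x) = δ_{ij}` (`exists_biorthogonal`). For a process `Z` with covariance `ρ_β`
the variables `N_i = ∑ x, A_i(x) Z(x)` are jointly Gaussian with identity covariance, and
`Z(b) - ∑ i, f_i(b) N_i` is centred with variance zero
(`exists_isStdNormalArray_of_covariance_eq_sum`). Path continuity turns the almost sure identity at
each `b` into one that holds for all `b` simultaneously. The equality of laws follows, because the
expansion is a fixed measurable function of the array.
-/

namespace SphereProj

open MvPolynomial (pderiv)

/-! ### Gaussian integrals of polynomials -/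

/-- Evaluation of a polynomial at a point of Euclidean space. -/
noncomputable abbrev evalAt {d : ℕ} (x : EuclideanSpace ℝ (Fin d))
    (p : MvPolynomial (Fin d) ℝ) : ℝ :=
  MvPolynomial.eval (fun i => x i) p

lemma restrictSphere_apply {d : ℕ} (p : MvPolynomial (Fin d) ℝ) (x : Sph d) :
    restrictSphere d p x = evalAt x.1 p := rfl

lemma evalAt_smul {d n : ℕ} {p : MvPolynomial (Fin d) ℝ} (hp : p.IsHomogeneous n) (c : ℝ)
    (x : EuclideanSpace ℝ (Fin d)) : evalAt (c • x) p = c ^ n * evalAt x p := by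
  simp only [evalAt, MvPolynomial.eval_eq, Finset.mul_sum]
  refine Finset.sum_congr rfl fun u hu => ?_
  have h : ∑ i, u i = n := by
    rw [← hp (MvPolynomial.mem_support_iff.1 hu), Finsupp.weight_apply,
      Finsupp.sum_fintype _ _ (by simp)]
    simp
  simp only [PiLp.smul_apply, smul_eq_mul, mul_pow]
  rw [← h, Finset.prod_subset (Finset.subset_univ u.support) (by simp +contextual),
    Finset.prod_subset (Finset.subset_univ u.support) (by simp +contextual),
    Finset.prod_mul_distrib, Finset.prod_pow_eq_pow_sum]
  ring

lemma integrable_pow_mul_gaussian (n : ℕ) :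
    Integrable fun t : ℝ => t ^ n * Real.exp (-t ^ 2 / 2) := by
  have h := integrable_rpow_mul_exp_neg_mul_sq (b := 1 / 2) (by norm_num) (s := n)
    (by have : (0 : ℝ) ≤ n := n.cast_nonneg
        linarith)
  refine h.congr (Filter.Eventually.of_forall fun t => ?_)
  simp only [Real.rpow_natCast]
  congr 2
  ring

lemma integrable_evalAt_mul_gaussian {d : ℕ} (p : MvPolynomial (Fin d) ℝ) :
    Integrable fun x : EuclideanSpace ℝ (Fin d) => evalAt x p * Real.exp (-‖x‖ ^ 2 / 2) := by
  induction p using MvPolynomial.induction_on' with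
  | add p q hp hq =>
    refine (hp.add hq).congr (Filter.Eventually.of_forall fun x => ?_)
    simp [add_mul]
  | monomial u a =>
    rw [← (PiLp.volume_preserving_toLp (Fin d)).integrable_comp_emb
      (MeasurableEquiv.toLp 2 _).measurableEmbedding]
    have h := (Integrable.fintype_prod
      (f := fun (i : Fin d) (t : ℝ) => t ^ u i * Real.exp (-t ^ 2 / 2))
      (fun i => integrable_pow_mul_gaussian (u i))).const_mul a
    refine h.congr (Filter.Eventually.of_forall fun x => ?_)
    simp only [Function.comp, evalAt, MvPolynomial.eval_monomial, Finset.prod_mul_distrib,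
      EuclideanSpace.norm_sq_eq, Finsupp.prod_pow, mul_assoc, ← Real.exp_sum]
    congr 3
    rw [← Finset.sum_neg_distrib, Finset.sum_div]
    simp

lemma hasLineDerivAt_evalAt {d : ℕ} (p : MvPolynomial (Fin d) ℝ) (i : Fin d)
    (x : EuclideanSpace ℝ (Fin d)) :
    HasLineDerivAt ℝ (fun x => evalAt x p) (evalAt x (pderiv i p)) x
      (EuclideanSpace.single i 1) := by
  unfold HasLineDerivAt
  induction p using MvPolynomial.induction_on with
  | C a => simpa using hasDerivAt_const (0 : ℝ) a
  | add p q hp hq =>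
    simp only [evalAt, map_add] at hp hq ⊢
    exact hp.add hq
  | mul_X p j hp =>
    have hX : HasDerivAt (fun t : ℝ =>
        evalAt (x + t • EuclideanSpace.single i (1 : ℝ)) (MvPolynomial.X j))
        (evalAt x (pderiv i (MvPolynomial.X j))) 0 := by
      rcases eq_or_ne j i with rfl | hne
      · simpa [evalAt] using (hasDerivAt_id (0 : ℝ)).const_add (x j)
      · simpa [evalAt, hne, MvPolynomial.pderiv_X_of_ne] using hasDerivAt_const (0 : ℝ) (x j)
    have h := HasDerivAt.mul hp hX
    rw [zero_smul, add_zero] at h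
    rw [Derivation.leibniz]
    simp only [evalAt, map_mul, map_add, smul_eq_mul] at h ⊢
    rw [add_comm, mul_comm (MvPolynomial.eval _ (MvPolynomial.X j))]
    exact h

lemma hasLineDerivAt_gaussian {d : ℕ} (i : Fin d) (x : EuclideanSpace ℝ (Fin d)) :
    HasLineDerivAt ℝ (fun x : EuclideanSpace ℝ (Fin d) => Real.exp (-‖x‖ ^ 2 / 2))
      (-(x i * Real.exp (-‖x‖ ^ 2 / 2))) x (EuclideanSpace.single i 1) := by
  have h := (((hasStrictFDerivAt_norm_sq x).hasFDerivAt.neg.mul_const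
    ((2 : ℝ)⁻¹)).exp).hasLineDerivAt (EuclideanSpace.single i 1)
  simp only [div_eq_mul_inv]
  have hval : (Real.exp ((-fun x => ‖x‖ ^ 2) x * 2⁻¹) • (2 : ℝ)⁻¹ • -(2 • (innerSL ℝ) x))
      (EuclideanSpace.single i 1) = -(x i * Real.exp (-‖x‖ ^ 2 * 2⁻¹)) := by
    simp [EuclideanSpace.inner_single_right]
    ring
  rw [hval] at h
  exact h

/-- The linear functional `p ↦ ∫ p(x) exp(-‖x‖² / 2) dx` on polynomials. -/
noncomputable def gaussInt (d : ℕ) : MvPolynomial (Fin d) ℝ →ₗ[ℝ] ℝ where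
  toFun p := ∫ x : EuclideanSpace ℝ (Fin d), evalAt x p * Real.exp (-‖x‖ ^ 2 / 2)
  map_add' p q := by
    rw [← integral_add (integrable_evalAt_mul_gaussian p) (integrable_evalAt_mul_gaussian q)]
    simp [add_mul]
  map_smul' c p := by
    simp [MvPolynomial.smul_eval, mul_assoc, integral_const_mul]

lemma gaussInt_apply {d : ℕ} (p : MvPolynomial (Fin d) ℝ) : gaussInt d p =
    ∫ x : EuclideanSpace ℝ (Fin d), evalAt x p * Real.exp (-‖x‖ ^ 2 / 2) := rfl

/-- Gaussian integration by parts. -/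
lemma gaussInt_X_mul {d : ℕ} (i : Fin d) (p : MvPolynomial (Fin d) ℝ) :
    gaussInt d (MvPolynomial.X i * p) = gaussInt d (pderiv i p) := by
  have h := integral_bilinear_hasLineDerivAt_right_eq_neg_left_of_integrable
    (μ := (volume : Measure (EuclideanSpace ℝ (Fin d))))
    (B := ContinuousLinearMap.mul ℝ ℝ) (v := EuclideanSpace.single i 1)
    (f := fun x => evalAt x p) (f' := fun x => evalAt x (pderiv i p))
    (g := fun x => Real.exp (-‖x‖ ^ 2 / 2)) (g' := fun x => -(x i * Real.exp (-‖x‖ ^ 2 / 2)))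
    (by simpa using integrable_evalAt_mul_gaussian (pderiv i p))
    (by
      refine (integrable_evalAt_mul_gaussian (MvPolynomial.X i * p)).neg.congr
        (Filter.Eventually.of_forall fun x => ?_)
      simp [evalAt]
      ring)
    (by simpa using integrable_evalAt_mul_gaussian p)
    (fun x _ => hasLineDerivAt_evalAt p i x) (fun x _ => hasLineDerivAt_gaussian i x)
  simp only [ContinuousLinearMap.mul_apply', mul_neg, integral_neg, neg_inj] at h
  rw [gaussInt_apply, gaussInt_apply, ← h]
  congr 1
  ext x
  simp [evalAt]
  ring

/-- The radial factor `∫_0^∞ r^{d-1+n} exp(-r² / 2) dr` of the Gaussian integral of a homogeneous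
polynomial of degree `n`. -/
noncomputable def radial (d n : ℕ) : ℝ :=
  ∫ r in Set.Ioi (0 : ℝ), r ^ (d - 1) * (r ^ n * Real.exp (-r ^ 2 / 2))

lemma radial_pos (d n : ℕ) : 0 < radial d n := by
  refine (setIntegral_pos_iff_support_of_nonneg_ae ?_ ?_).2 ?_
  · filter_upwards [ae_restrict_mem measurableSet_Ioi] with r hr
    have : (0 : ℝ) < r := hr
    simp only [Pi.zero_apply]
    positivity
  · refine (integrable_pow_mul_gaussian (d - 1 + n)).integrableOn.congr_fun (fun r _ => ?_)
      measurableSet_Ioi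
    simp only [pow_add]
    ring
  · have : Function.support (fun r : ℝ => r ^ (d - 1) * (r ^ n * Real.exp (-r ^ 2 / 2))) ∩
        Set.Ioi 0 = Set.Ioi 0 := by
      refine Set.inter_eq_right.2 fun r hr => ?_
      have : (0 : ℝ) < r := hr
      simp only [Function.mem_support]
      positivity
    rw [this]
    simp

lemma integral_volumeIoiPow (n : ℕ) (f : ℝ → ℝ) :
    ∫ r : Set.Ioi (0 : ℝ), f r ∂(Measure.volumeIoiPow n) = ∫ r in Set.Ioi (0 : ℝ), r ^ n * f r := by
  simp only [Measure.volumeIoiPow, ENNReal.ofReal]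
  rw [integral_withDensity_eq_integral_smul,
    integral_subtype_comap measurableSet_Ioi fun a ↦ Real.toNNReal (a ^ n) • f a,
    setIntegral_congr_fun measurableSet_Ioi fun x hx ↦ ?_]
  · rw [NNReal.smul_def, Real.coe_toNNReal _ (pow_nonneg (le_of_lt hx) _), smul_eq_mul]
  · exact (measurable_subtype_coe.pow_const _).real_toNNReal

/-- Polar coordinates for homogeneous polynomials. -/
lemma gaussInt_eq_radial_mul {d n : ℕ} (hd : 1 ≤ d) {p : MvPolynomial (Fin d) ℝ}
    (hp : p.IsHomogeneous n) :
    gaussInt d p = radial d n * ∫ ω, restrictSphere d p ω ∂(surface d) := by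
  have : Nonempty (Fin d) := ⟨⟨0, hd⟩⟩
  set μ : Measure (EuclideanSpace ℝ (Fin d)) := volume
  have hfin : Module.finrank ℝ (EuclideanSpace ℝ (Fin d)) = d := by simp
  calc gaussInt d p
      = ∫ x : ({(0)}ᶜ : Set (EuclideanSpace ℝ (Fin d))),
          evalAt x.1 p * Real.exp (-‖x.1‖ ^ 2 / 2) ∂(μ.comap (↑)) := by
        rw [integral_subtype_comap (measurableSet_singleton _).compl
          fun x => evalAt x p * Real.exp (-‖x‖ ^ 2 / 2), restrict_compl_singleton, gaussInt_apply]
    _ = ∫ z : Sph d × Set.Ioi (0 : ℝ), restrictSphere d p z.1 *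
          (z.2.1 ^ n * Real.exp (-z.2.1 ^ 2 / 2)) ∂(μ.toSphere.prod (.volumeIoiPow (d - 1))) := by
        have h := μ.measurePreserving_homeomorphUnitSphereProd.integral_comp
          (Homeomorph.measurableEmbedding _) (fun z : Sph d × Set.Ioi (0 : ℝ) =>
            restrictSphere d p z.1 * (z.2.1 ^ n * Real.exp (-z.2.1 ^ 2 / 2)))
        rw [hfin] at h
        rw [← h]
        congr 1
        ext x
        have hx : ‖x.1‖ ≠ 0 := norm_ne_zero_iff.2 x.2
        have h1 : evalAt x.1 p = ‖x.1‖ ^ n * evalAt (‖x.1‖⁻¹ • x.1) p := by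
          rw [← evalAt_smul hp, smul_inv_smul₀ hx]
        rw [h1, restrictSphere_apply]
        simp only [homeomorphUnitSphereProd_apply_snd_coe, homeomorphUnitSphereProd_apply_fst_coe]
        ring
    _ = _ := by
        rw [integral_prod_mul (fun ω => restrictSphere d p ω)
          (fun r : Set.Ioi (0 : ℝ) => r.1 ^ n * Real.exp (-r.1 ^ 2 / 2)),
          integral_volumeIoiPow (d - 1) (fun r => r ^ n * Real.exp (-r ^ 2 / 2)), mul_comm]
        rfl

variable {d : ℕ}

/-! ### Laplacians, linear forms and the squared norm -/

lemma laplacianPoly_apply (p : MvPolynomial (Fin d) ℝ) :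
    laplacianPoly d p = ∑ i, pderiv i (pderiv i p) := by
  simp [laplacianPoly]

lemma laplacianPoly_mul (p q : MvPolynomial (Fin d) ℝ) :
    laplacianPoly d (p * q) = laplacianPoly d p * q +
      2 * ∑ i, pderiv i p * pderiv i q + p * laplacianPoly d q := by
  simp only [laplacianPoly_apply, Finset.sum_mul, Finset.mul_sum, ← Finset.sum_add_distrib]
  refine Finset.sum_congr rfl fun i _ => ?_
  simp only [Derivation.leibniz, map_add, smul_eq_mul]
  ring

lemma pderiv_comm (i j : Fin d) (p : MvPolynomial (Fin d) ℝ) :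
    pderiv i (pderiv j p) = pderiv j (pderiv i p) := by
  induction p using MvPolynomial.induction_on with
  | C a => simp
  | add p q hp hq => simp [hp, hq]
  | mul_X p l hp =>
    simp only [Derivation.leibniz, map_add, smul_eq_mul, hp, MvPolynomial.pderiv_X]
    rcases eq_or_ne l i with rfl | h <;> rcases eq_or_ne l j with rfl | h' <;>
      simp_all <;> ring

/-- The linear form `x ↦ ⟨a, x⟩` as a polynomial. -/
noncomputable def linForm (a : EuclideanSpace ℝ (Fin d)) : MvPolynomial (Fin d) ℝ :=
  ∑ i, MvPolynomial.C (a i) * MvPolynomial.X i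

/-- The polynomial `x ↦ ‖x‖²`. -/
noncomputable def normSqPoly (d : ℕ) : MvPolynomial (Fin d) ℝ :=
  ∑ i, MvPolynomial.X i ^ 2

lemma evalAt_linForm (a x : EuclideanSpace ℝ (Fin d)) : evalAt x (linForm a) = ⟪a, x⟫ := by
  simp [linForm, evalAt, PiLp.inner_apply, mul_comm]

lemma evalAt_normSqPoly (x : EuclideanSpace ℝ (Fin d)) : evalAt x (normSqPoly d) = ‖x‖ ^ 2 := by
  simp [normSqPoly, evalAt, EuclideanSpace.norm_sq_eq]

lemma pderiv_linForm (a : EuclideanSpace ℝ (Fin d)) (i : Fin d) :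
    pderiv i (linForm a) = MvPolynomial.C (a i) := by
  simp [linForm, MvPolynomial.pderiv_X, Derivation.leibniz, Pi.single_apply]

lemma pderiv_normSqPoly (i : Fin d) :
    pderiv i (normSqPoly d) = 2 * MvPolynomial.X i := by
  simp [normSqPoly, MvPolynomial.pderiv_X, Derivation.leibniz_pow, Pi.single_apply]

lemma isHomogeneous_linForm (a : EuclideanSpace ℝ (Fin d)) : (linForm a).IsHomogeneous 1 :=
  MvPolynomial.IsHomogeneous.sum _ _ _ fun i _ => by
    simpa using (MvPolynomial.isHomogeneous_C _ (a i)).mul (MvPolynomial.isHomogeneous_X ℝ i)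

lemma isHomogeneous_linForm_pow (a : EuclideanSpace ℝ (Fin d)) (m : ℕ) :
    (linForm a ^ m).IsHomogeneous m := by
  simpa using (isHomogeneous_linForm a).pow m

lemma isHomogeneous_normSqPoly_pow (d m : ℕ) : (normSqPoly d ^ m).IsHomogeneous (2 * m) :=
  (MvPolynomial.IsHomogeneous.sum _ _ _ fun i _ => by
    simpa using (MvPolynomial.isHomogeneous_X ℝ i).pow 2).pow m

lemma sum_sq_eq_one (a : Sph d) : ∑ i, a.1 i ^ 2 = 1 := by
  have h : ‖a.1‖ = 1 := by simp
  have := EuclideanSpace.norm_sq_eq a.1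
  simpa [h] using this.symm

lemma sum_C_mul_C (a : Sph d) :
    ∑ i, (MvPolynomial.C (a.1 i) * MvPolynomial.C (a.1 i) : MvPolynomial (Fin d) ℝ) = 1 := by
  have h := congrArg (MvPolynomial.C : ℝ → MvPolynomial (Fin d) ℝ) (sum_sq_eq_one a)
  simpa [pow_two] using h

/-! ### Gaussian integrals against harmonic polynomials -/

lemma gaussInt_sum_X_mul (f : Fin d → MvPolynomial (Fin d) ℝ) :
    gaussInt d (∑ i, MvPolynomial.X i * f i) = ∑ i, gaussInt d (pderiv i (f i)) := by
  simp [map_sum, gaussInt_X_mul]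

/-- Green's identity for the Gaussian weight: integration by parts and Euler's identity. The left
side is symmetric in `p` and `q`. -/
lemma gaussInt_sum_pderiv_mul {l : ℕ} (p : MvPolynomial (Fin d) ℝ) {q : MvPolynomial (Fin d) ℝ}
    (hq : q.IsHomogeneous l) (hΔ : laplacianPoly d q = 0) :
    gaussInt d (∑ i, pderiv i p * pderiv i q) = l * gaussInt d (p * q) := by
  have h1 := gaussInt_sum_X_mul fun i => p * pderiv i q
  have h2 : ∑ i, MvPolynomial.X i * (p * pderiv i q) = (l : ℝ) • (p * q) := by
    rw [Nat.cast_smul_eq_nsmul, ← mul_smul_comm, ← hq.sum_X_mul_pderiv, Finset.mul_sum]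
    exact Finset.sum_congr rfl fun i _ => by ring
  rw [h2, map_smul, smul_eq_mul] at h1
  rw [h1, ← map_sum]
  congr 1
  have h3 : ∑ i, p * pderiv i (pderiv i q) = 0 := by
    rw [← Finset.mul_sum, ← laplacianPoly_apply, hΔ, mul_zero]
  rw [← add_zero (∑ i, pderiv i p * pderiv i q), ← h3, ← Finset.sum_add_distrib]
  refine Finset.sum_congr rfl fun i _ => ?_
  simp only [Derivation.leibniz, smul_eq_mul]
  ring

/-- Homogeneous harmonic polynomials of different degrees are orthogonal. -/
lemma gaussInt_mul_eq_zero {k l : ℕ} (hkl : k ≠ l) {p q : MvPolynomial (Fin d) ℝ}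
    (hp : p.IsHomogeneous k) (hpΔ : laplacianPoly d p = 0)
    (hq : q.IsHomogeneous l) (hqΔ : laplacianPoly d q = 0) : gaussInt d (p * q) = 0 := by
  have h1 := gaussInt_sum_pderiv_mul p hq hqΔ
  have h2 := gaussInt_sum_pderiv_mul q hp hpΔ
  simp only [mul_comm q, mul_comm (pderiv _ q)] at h2
  have h : ((k : ℝ) - l) * gaussInt d (p * q) = 0 := by rw [sub_mul, ← h1, ← h2, sub_self]
  exact (mul_eq_zero.1 h).resolve_left (sub_ne_zero.2 (by exact_mod_cast hkl))

/-- The combinatorial factor in the Gaussian integral of `⟨a, ·⟩ ^ m * h` for `h` harmonic and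
homogeneous of degree `k`. The subtractions do no harm: a term in which one of them is truncated
carries a factor `0`. -/
noncomputable def gaussFactor : ℕ → ℕ → ℝ
  | 0, k => if k = 0 then 1 else 0
  | m + 1, k => m * gaussFactor (m - 1) k + k * gaussFactor m (k - 1)
termination_by m => m
decreasing_by all_goals omega

lemma gaussFactor_zero (k : ℕ) : gaussFactor 0 k = if k = 0 then 1 else 0 := by
  rw [gaussFactor]

lemma gaussFactor_succ (m k : ℕ) :
    gaussFactor (m + 1) k = m * gaussFactor (m - 1) k + k * gaussFactor m (k - 1) := by
  rw [gaussFactor]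

lemma gaussFactor_nonneg (m k : ℕ) : 0 ≤ gaussFactor m k := by
  induction m using Nat.strong_induction_on generalizing k with
  | _ m ih =>
    cases m with
    | zero => rw [gaussFactor_zero]; split_ifs <;> norm_num
    | succ m =>
      rw [gaussFactor_succ]
      exact add_nonneg (mul_nonneg m.cast_nonneg (ih _ (by omega) _))
        (mul_nonneg k.cast_nonneg (ih _ (by omega) _))

lemma gaussFactor_pos {m k : ℕ} (hkm : k ≤ m) (h2 : k % 2 = m % 2) : 0 < gaussFactor m k := by
  induction m using Nat.strong_induction_on generalizing k with
  | _ m ih =>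
    cases m with
    | zero => simp [gaussFactor_zero, Nat.le_zero.1 hkm]
    | succ m =>
      rw [gaussFactor_succ]
      rcases Nat.eq_zero_or_pos k with rfl | hk
      · have hm : 0 < m := by omega
        have := ih (m - 1) (by omega) (k := 0) (by omega) (by omega)
        simp only [Nat.cast_zero, zero_mul, add_zero]
        positivity
      · have := ih m (by omega) (k := k - 1) (by omega) (by omega)
        have := gaussFactor_nonneg (m - 1) k
        positivity

lemma gaussFactor_eq_zero {m k : ℕ} (h2 : k % 2 ≠ m % 2) : gaussFactor m k = 0 := by
  induction m using Nat.strong_induction_on generalizing k with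
  | _ m ih =>
    cases m with
    | zero =>
      have : k ≠ 0 := by rintro rfl; simp at h2
      simp [gaussFactor_zero, this]
    | succ m =>
      rw [gaussFactor_succ]
      rcases Nat.eq_zero_or_pos k with rfl | hk <;> rcases Nat.eq_zero_or_pos m with rfl | hm
      · simp
      · simp [ih (m - 1) (by omega) (k := 0) (by omega)]
      · simp [ih 0 (by omega) (k := k - 1) (by omega)]
      · simp [ih (m - 1) (by omega) (k := k) (by omega), ih m (by omega) (k := k - 1) (by omega)]

lemma gaussInt_C_mul (c : ℝ) (p : MvPolynomial (Fin d) ℝ) :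
    gaussInt d (MvPolynomial.C c * p) = c * gaussInt d p := by
  rw [MvPolynomial.C_mul', map_smul, smul_eq_mul]

/-- Gaussian form of the Funk–Hecke formula for the powers `t ^ m`: integrating one factor `⟨a, x⟩`
by parts lowers `m`, either alone or together with the degree of `h`. -/
lemma gaussInt_linForm_pow_mul (a : Sph d) (m : ℕ) {k : ℕ} {h : MvPolynomial (Fin d) ℝ}
    (hh : h.IsHomogeneous k) (hΔ : laplacianPoly d h = 0) :
    gaussInt d (linForm a.1 ^ m * h) = gaussFactor m k * evalAt a.1 h * gaussInt d 1 := by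
  induction m using Nat.strong_induction_on generalizing k h with
  | _ m ih =>
    cases m with
    | zero =>
      rw [gaussFactor_zero, pow_zero, one_mul]
      split_ifs with hk
      · subst hk
        rw [← MvPolynomial.totalDegree_zero_iff_isHomogeneous,
          MvPolynomial.totalDegree_eq_zero_iff_eq_C] at hh
        rw [hh, ← mul_one (MvPolynomial.C _), gaussInt_C_mul]
        simp
      · have := gaussInt_sum_pderiv_mul 1 hh hΔ
        simp only [Derivation.map_one_eq_zero, zero_mul, Finset.sum_const_zero, map_zero,
          one_mul] at this
        simpa [hk] using this.symm
    | succ m =>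
      -- The directional derivative of `h` along `a` is harmonic of degree `k - 1`.
      set g : MvPolynomial (Fin d) ℝ := ∑ i, MvPolynomial.C (a.1 i) * pderiv i h with hg
      have hg1 : g.IsHomogeneous (k - 1) := MvPolynomial.IsHomogeneous.sum _ _ _ fun i _ => by
        simpa using (MvPolynomial.isHomogeneous_C _ (a.1 i)).mul hh.pderiv
      have hg2 : laplacianPoly d g = 0 := by
        have : ∀ i, ∑ j, pderiv j (pderiv j (pderiv i h)) = 0 := fun i => by
          simp only [pderiv_comm _ i]
          rw [← map_sum, ← laplacianPoly_apply, hΔ, map_zero]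
        simp only [hg, map_sum, laplacianPoly_apply, MvPolynomial.C_mul', map_smul,
          this, smul_zero, Finset.sum_const_zero]
      have hg3 : evalAt a.1 g = k * evalAt a.1 h := by
        have := congrArg (evalAt a.1) hh.sum_X_mul_pderiv
        simpa [hg, evalAt] using this
      have key : gaussInt d (linForm a.1 ^ (m + 1) * h) =
          m * gaussInt d (linForm a.1 ^ (m - 1) * h) + gaussInt d (linForm a.1 ^ m * g) := by
        have e1 : linForm a.1 ^ (m + 1) * h =
            ∑ i, MvPolynomial.X i * (MvPolynomial.C (a.1 i) * (linForm a.1 ^ m * h)) := by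
          rw [pow_succ', mul_assoc]
          nth_rw 1 [linForm]
          rw [Finset.sum_mul]
          exact Finset.sum_congr rfl fun i _ => by ring
        rw [e1, gaussInt_sum_X_mul, ← smul_eq_mul (m : ℝ), ← map_smul, ← map_add, ← map_sum]
        congr 1
        have e2 : (m : ℝ) • (linForm a.1 ^ (m - 1) * h) =
            ∑ i, (m : ℝ) • (linForm a.1 ^ (m - 1) * h) *
              (MvPolynomial.C (a.1 i) * MvPolynomial.C (a.1 i)) := by
          rw [← Finset.mul_sum, sum_C_mul_C, mul_one]
        rw [e2, hg, Finset.mul_sum, ← Finset.sum_add_distrib]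
        refine Finset.sum_congr rfl fun i _ => ?_
        simp only [Derivation.leibniz, Derivation.leibniz_pow, pderiv_linForm, smul_eq_mul,
          MvPolynomial.pderiv_C, mul_zero, add_zero, nsmul_eq_mul, MvPolynomial.smul_eq_C_mul,
          map_natCast]
        ring
      rw [key, ih (m - 1) (by omega) hh hΔ, ih m (by omega) hg1 hg2, hg3, gaussFactor_succ]
      ring

/-! ### Laplacians of zonal polynomials -/

lemma laplacianPoly_pow (f : MvPolynomial (Fin d) ℝ) (m : ℕ) :
    laplacianPoly d (f ^ (m + 1)) =
      (m + 1) * (m * f ^ (m - 1) * ∑ i, pderiv i f ^ 2 + f ^ m * laplacianPoly d f) := by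
  simp only [laplacianPoly_apply, Finset.mul_sum, ← Finset.sum_add_distrib]
  refine Finset.sum_congr rfl fun i _ => ?_
  simp only [Derivation.leibniz_pow, Derivation.leibniz, smul_eq_mul, nsmul_eq_mul,
    Derivation.map_natCast, Nat.add_sub_cancel]
  push_cast
  ring

lemma laplacianPoly_linForm_pow (a : Sph d) (m : ℕ) :
    laplacianPoly d (linForm a.1 ^ m) =
      MvPolynomial.C ((m : ℝ) * (m - 1)) * linForm a.1 ^ (m - 2) := by
  rcases m with _ | m
  · simp [laplacianPoly_apply]
  have h : laplacianPoly d (linForm a.1) = 0 := by simp [laplacianPoly_apply, pderiv_linForm]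
  simp only [laplacianPoly_pow, pderiv_linForm, h, pow_two, sum_C_mul_C]
  rw [show m + 1 - 2 = m - 1 by omega]
  simp
  ring

lemma laplacianPoly_normSqPoly_pow (d j : ℕ) :
    laplacianPoly d (normSqPoly d ^ (j + 1)) =
      MvPolynomial.C (2 * ((j : ℝ) + 1) * (2 * j + d)) * normSqPoly d ^ j := by
  have hC : (MvPolynomial.C 2 : MvPolynomial (Fin d) ℝ) = 2 := map_ofNat _ 2
  have h : laplacianPoly d (normSqPoly d) = 2 * d := by
    simp only [laplacianPoly_apply, pderiv_normSqPoly, ← hC, MvPolynomial.pderiv_C_mul,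
      MvPolynomial.pderiv_X_self]
    simp [hC, mul_comm]
  have h2 : ∑ i : Fin d, pderiv i (normSqPoly d) ^ 2 = 4 * normSqPoly d := by
    simp only [pderiv_normSqPoly, mul_pow, ← Finset.mul_sum]
    rw [normSqPoly]
    norm_num
  rw [laplacianPoly_pow, h, h2]
  rcases j with _ | j
  · simp [hC]
  · simp [hC]
    ring

lemma laplacianPoly_zonal (a : Sph d) (m j : ℕ) :
    laplacianPoly d (linForm a.1 ^ m * normSqPoly d ^ (j + 1)) =
      MvPolynomial.C ((m : ℝ) * (m - 1)) * (linForm a.1 ^ (m - 2) * normSqPoly d ^ (j + 1)) +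
      MvPolynomial.C (2 * ((j : ℝ) + 1) * (2 * j + d + 2 * m)) *
        (linForm a.1 ^ m * normSqPoly d ^ j) := by
  have hC : (MvPolynomial.C 2 : MvPolynomial (Fin d) ℝ) = 2 := map_ofNat _ 2
  rw [laplacianPoly_mul, laplacianPoly_linForm_pow, laplacianPoly_normSqPoly_pow]
  have h : ∑ i, pderiv i (linForm a.1 ^ m) * pderiv i (normSqPoly d ^ (j + 1)) =
      MvPolynomial.C (2 * ((j : ℝ) + 1) * m) * (linForm a.1 ^ m * normSqPoly d ^ j) := by
    rcases m with _ | m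
    · simp
    have : ∀ i, pderiv i (linForm a.1 ^ (m + 1)) * pderiv i (normSqPoly d ^ (j + 1)) =
        MvPolynomial.C (2 * ((j : ℝ) + 1) * (m + 1 : ℕ)) * (linForm a.1 ^ m * normSqPoly d ^ j) *
          (MvPolynomial.C (a.1 i) * MvPolynomial.X i) := fun i => by
      simp only [Derivation.leibniz_pow, pderiv_linForm, pderiv_normSqPoly, smul_eq_mul,
        nsmul_eq_mul, Nat.add_sub_cancel]
      simp [hC]
      ring
    simp only [this]
    rw [← Finset.mul_sum, ← linForm]
    ring
  rw [h]
  simp [hC]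
  ring

/-! ### Integration over the sphere -/

instance : IsFiniteMeasure (surface d) := by unfold surface; infer_instance

instance : (surface d).IsOpenPosMeasure := by unfold surface; infer_instance

lemma nonempty_sph (hd : 1 ≤ d) : Nonempty (Sph d) :=
  ⟨⟨EuclideanSpace.single ⟨0, hd⟩ 1, by simp⟩⟩

lemma area_pos (hd : 1 ≤ d) : 0 < area d := by
  have := nonempty_sph hd
  rw [area, measureReal_def]
  exact ENNReal.toReal_pos (isOpen_univ.measure_ne_zero _ Set.univ_nonempty)
    (measure_ne_top _ _)

lemma integrable_sph (f : C(Sph d, ℝ)) : Integrable f (surface d) :=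
  f.continuous.integrable_of_hasCompactSupport (HasCompactSupport.of_compactSpace f)

/-- The integral over the sphere as a linear functional on continuous functions. -/
noncomputable def sphInt (d : ℕ) : C(Sph d, ℝ) →ₗ[ℝ] ℝ where
  toFun f := ∫ ω, f ω ∂(surface d)
  map_add' f g := integral_add (integrable_sph f) (integrable_sph g)
  map_smul' c f := integral_const_mul c f

lemma sphInt_apply (f : C(Sph d, ℝ)) : sphInt d f = ∫ ω, f ω ∂(surface d) := rfl

lemma sphInt_one : sphInt d 1 = area d := by
  simp [sphInt_apply, area]

lemma restrictSphere_mul (p q : MvPolynomial (Fin d) ℝ) :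
    restrictSphere d (p * q) = restrictSphere d p * restrictSphere d q := by
  ext x
  simp [restrictSphere_apply]

lemma restrictSphere_one : restrictSphere d 1 = 1 := by
  ext x
  simp [restrictSphere_apply]

lemma evalAt_pow (x : EuclideanSpace ℝ (Fin d)) (p : MvPolynomial (Fin d) ℝ) (m : ℕ) :
    evalAt x (p ^ m) = evalAt x p ^ m := map_pow _ p m

lemma mem_harmonics {k : ℕ} {f : C(Sph d, ℝ)} : f ∈ harmonics d k ↔
    ∃ p : MvPolynomial (Fin d) ℝ, p.IsHomogeneous k ∧ laplacianPoly d p = 0 ∧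
      restrictSphere d p = f := by
  simp [harmonics, and_assoc]

/-- Spherical harmonics of different orders are orthogonal. -/
lemma sphInt_mul_eq_zero (hd : 1 ≤ d) {k l : ℕ} (hkl : k ≠ l) {f g : C(Sph d, ℝ)}
    (hf : f ∈ harmonics d k) (hg : g ∈ harmonics d l) : sphInt d (f * g) = 0 := by
  obtain ⟨p, hp, hpΔ, rfl⟩ := mem_harmonics.1 hf
  obtain ⟨q, hq, hqΔ, rfl⟩ := mem_harmonics.1 hg
  have h := gaussInt_eq_radial_mul hd (hp.mul hq)
  rw [gaussInt_mul_eq_zero hkl hp hpΔ hq hqΔ, restrictSphere_mul] at h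
  exact (mul_eq_zero.1 h.symm).resolve_left (radial_pos d _).ne'

/-- The function `ω ↦ ⟨a, ω⟩ ^ m` on the sphere. -/
noncomputable def zonalPow (a : Sph d) (m : ℕ) : C(Sph d, ℝ) :=
  restrictSphere d (linForm a.1 ^ m)

lemma zonalPow_apply (a ω : Sph d) (m : ℕ) : zonalPow a m ω = ⟪a.1, ω.1⟫ ^ m := by
  rw [zonalPow, restrictSphere_apply, evalAt_pow, evalAt_linForm]

/-- The constant `μ` with `∫ ⟨a, ω⟩ ^ m f(ω) dσ(ω) = μ f(a)` for all spherical harmonics `f` of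
order `k`. -/
noncomputable def zonalMoment (d m k : ℕ) : ℝ :=
  gaussFactor m k * (radial d 0 * area d) / radial d (m + k)

lemma gaussInt_one (hd : 1 ≤ d) : gaussInt d 1 = radial d 0 * area d := by
  rw [gaussInt_eq_radial_mul hd (MvPolynomial.isHomogeneous_one _ _), ← sphInt_apply,
    restrictSphere_one, sphInt_one]

/-- The Funk–Hecke formula for the powers `t ^ m`. -/
lemma sphInt_zonalPow_mul (hd : 1 ≤ d) (a : Sph d) (m : ℕ) {k : ℕ} {f : C(Sph d, ℝ)}
    (hf : f ∈ harmonics d k) : sphInt d (zonalPow a m * f) = zonalMoment d m k * f a := by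
  obtain ⟨p, hp, hpΔ, rfl⟩ := mem_harmonics.1 hf
  have h := gaussInt_eq_radial_mul hd ((isHomogeneous_linForm_pow a.1 m).mul hp)
  rw [gaussInt_linForm_pow_mul a m hp hpΔ, gaussInt_one hd, restrictSphere_mul] at h
  have hr := (radial_pos d (m + k)).ne'
  rw [zonalMoment, div_mul_eq_mul_div, eq_div_iff hr, mul_comm (sphInt d _), restrictSphere_apply]
  exact h.symm.trans (by ring)

lemma zonalMoment_pos (hd : 1 ≤ d) {m k : ℕ} (hkm : k ≤ m) (h2 : k % 2 = m % 2) :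
    0 < zonalMoment d m k :=
  div_pos (mul_pos (gaussFactor_pos hkm h2) (mul_pos (radial_pos d 0) (area_pos hd)))
    (radial_pos d _)

lemma zonalMoment_eq_zero {m k : ℕ} (h2 : k % 2 ≠ m % 2) : zonalMoment d m k = 0 := by
  simp [zonalMoment, gaussFactor_eq_zero h2]

lemma one_mem_harmonics : (1 : C(Sph d, ℝ)) ∈ harmonics d 0 :=
  mem_harmonics.2 ⟨1, MvPolynomial.isHomogeneous_one _ _, by simp [laplacianPoly_apply],
    restrictSphere_one⟩

lemma sphInt_zonalPow (hd : 1 ≤ d) (a : Sph d) (m : ℕ) :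
    sphInt d (zonalPow a m) = zonalMoment d m 0 := by
  simpa using sphInt_zonalPow_mul hd a m one_mem_harmonics

/-- The recursion for the moments `∫ ⟨a, ω⟩ ^ m dσ(ω)`. -/
lemma zonalMoment_add_two_zero (hd : 1 ≤ d) (m : ℕ) :
    (d + m) * zonalMoment d (m + 2) 0 = (m + 1) * zonalMoment d m 0 := by
  obtain ⟨a⟩ := nonempty_sph hd
  have hhom := isHomogeneous_linForm_pow a.1 m
  -- Integration by parts against `‖x‖²`, using Euler's identity.
  have h1 : gaussInt d (normSqPoly d * linForm a.1 ^ m) =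
      (d + m) * gaussInt d (linForm a.1 ^ m) := by
    have e : normSqPoly d * linForm a.1 ^ m =
        ∑ i, MvPolynomial.X i * (MvPolynomial.X i * linForm a.1 ^ m) := by
      rw [normSqPoly, Finset.sum_mul]
      exact Finset.sum_congr rfl fun i _ => by ring
    rw [e, gaussInt_sum_X_mul, ← map_sum, ← smul_eq_mul, ← map_smul, add_smul,
      Nat.cast_smul_eq_nsmul, Nat.cast_smul_eq_nsmul, ← hhom.sum_X_mul_pderiv]
    simp [Derivation.leibniz, Finset.sum_add_distrib, add_comm]
  have h2 : restrictSphere d (normSqPoly d * linForm a.1 ^ m) = zonalPow a m := by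
    ext x
    rw [restrictSphere_mul, zonalPow, ContinuousMap.mul_apply, restrictSphere_apply,
      evalAt_normSqPoly]
    simp
  have h3 := gaussInt_eq_radial_mul hd ((isHomogeneous_normSqPoly_pow d 1).mul hhom)
  rw [pow_one, h1, h2, ← mul_one (linForm a.1 ^ m), gaussInt_linForm_pow_mul a m
    (MvPolynomial.isHomogeneous_one _ _) (by simp [laplacianPoly_apply]), ← sphInt_apply,
    sphInt_zonalPow hd, gaussInt_one hd] at h3
  have hr := (radial_pos d (m + 2)).ne'
  have h4 : gaussFactor (m + 2) 0 = (m + 1) * gaussFactor m 0 := by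
    rw [gaussFactor_succ]
    simp
  have h5 : zonalMoment d (m + 2) 0 = (m + 1) * gaussFactor m 0 * (radial d 0 * area d) /
      radial d (m + 2) := by
    rw [zonalMoment, h4, add_zero]
  rw [h5]
  rw [mul_one, add_comm m] at *
  field_simp
  simp at h3
  linarith

/-! ### Zonal decomposition of powers -/

/-- Each monomial `⟨a, ω⟩ ^ k` can be corrected, by monomials of lower degree, to a polynomial
whose Laplacian is divisible by a given power of `‖x‖²`. -/
lemma exists_partial_zonal (hd : 1 ≤ d) (a : Sph d) (J m : ℕ) :
    ∃ (q : MvPolynomial (Fin d) ℝ) (γ : ℝ), q.IsHomogeneous (m + 2 * J) ∧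
      laplacianPoly d q = MvPolynomial.C (γ * (m * (m - 1))) *
        (linForm a.1 ^ (m - 2) * normSqPoly d ^ J) ∧
      restrictSphere d q - zonalPow a (m + 2 * J) ∈
        Submodule.span ℝ (zonalPow a '' Set.Iio (m + 2 * J)) := by
  induction J generalizing m with
  | zero =>
    refine ⟨linForm a.1 ^ m, 1, isHomogeneous_linForm_pow _ _, ?_, ?_⟩
    · simp [laplacianPoly_linForm_pow]
    · simp [zonalPow]
  | succ J ih =>
    obtain ⟨q, γ, hq, hΔ, hres⟩ := ih (m + 2)
    rw [show m + 2 + 2 * J = m + 2 * (J + 1) by ring] at hq hres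
    -- `δ` is chosen so that `δ ⟨a, x⟩ ^ m ‖x‖ ^ (2 (J + 1))` cancels the Laplacian of `q`.
    set D : ℝ := 2 * ((J : ℝ) + 1) * (2 * J + d + 2 * m) with hD
    have hDpos : D ≠ 0 := by
      have : (1 : ℝ) ≤ d := by exact_mod_cast hd
      positivity
    set δ : ℝ := -(γ * ((m + 2 : ℕ) * ((m + 2 : ℕ) - 1))) / D with hδ
    have hcancel : δ * D = -(γ * ((m + 2 : ℕ) * ((m + 2 : ℕ) - 1))) := div_mul_cancel₀ _ hDpos
    refine ⟨q + MvPolynomial.C δ * (linForm a.1 ^ m * normSqPoly d ^ (J + 1)), δ, ?_, ?_, ?_⟩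
    · refine hq.add ?_
      simpa using (MvPolynomial.isHomogeneous_C _ δ).mul
        ((isHomogeneous_linForm_pow a.1 m).mul (isHomogeneous_normSqPoly_pow d (J + 1)))
    · rw [map_add, MvPolynomial.C_mul', map_smul, laplacianPoly_zonal, hΔ, smul_add,
        ← MvPolynomial.C_mul', ← MvPolynomial.C_mul', ← hD, ← mul_assoc,
        ← mul_assoc (MvPolynomial.C δ) (MvPolynomial.C D),
        ← MvPolynomial.C_mul, hcancel, Nat.add_sub_cancel]
      simp only [map_neg, MvPolynomial.C_mul]
      ring
    · have : restrictSphere d (linForm a.1 ^ m * normSqPoly d ^ (J + 1)) = zonalPow a m := by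
        ext x
        rw [restrictSphere_mul, zonalPow, ContinuousMap.mul_apply,
          restrictSphere_apply (normSqPoly d ^ _), evalAt_pow,
          evalAt_normSqPoly]
        simp
      rw [map_add, MvPolynomial.C_mul', map_smul, this, add_sub_right_comm]
      exact add_mem hres (Submodule.smul_mem _ _ (Submodule.subset_span
        ⟨m, by simp only [Set.mem_Iio]; omega, rfl⟩))

/-- `⟨a, ω⟩ ^ m` is a sum of spherical harmonics of orders at most `m`. -/
lemma zonalPow_mem_iSup (hd : 1 ≤ d) (a : Sph d) (m : ℕ) :
    zonalPow a m ∈ ⨆ k ∈ Finset.range (m + 1), harmonics d k := by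
  induction m using Nat.strong_induction_on with
  | _ m ih =>
    obtain ⟨q, γ, hq, hΔ, hres⟩ := exists_partial_zonal hd a (m / 2) (m % 2)
    rw [Nat.mod_add_div] at hq hres
    -- The remaining exponent `m % 2` is `0` or `1`, so the Laplacian of `q` vanishes.
    have h0 : ((m % 2 : ℕ) : ℝ) * ((m % 2 : ℕ) - 1) = 0 := by
      rcases Nat.mod_two_eq_zero_or_one m with h | h <;> simp [h]
    rw [h0, mul_zero, map_zero, zero_mul] at hΔ
    have hle : Submodule.span ℝ (zonalPow a '' Set.Iio m) ≤
        ⨆ k ∈ Finset.range (m + 1), harmonics d k := by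
      rw [Submodule.span_le]
      rintro _ ⟨j, hj, rfl⟩
      have hj' : j < m := hj
      exact (biSup_mono fun k hk => by simp at hk ⊢; omega :
        ⨆ k ∈ Finset.range (j + 1), harmonics d k ≤ _) (ih j hj')
    have hq' : restrictSphere d q ∈ ⨆ k ∈ Finset.range (m + 1), harmonics d k :=
      Submodule.mem_iSup_of_mem m (Submodule.mem_iSup_of_mem (by simp)
        (mem_harmonics.2 ⟨q, hq, hΔ, rfl⟩))
    simpa using sub_mem hq' (hle hres)

/-! ### Orthonormal bases -/

lemma finite_harmonics (d k : ℕ) : FiniteDimensional ℝ (harmonics d k) := by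
  have h1 : FiniteDimensional ℝ (MvPolynomial.homogeneousSubmodule (Fin d) ℝ k) :=
    Module.Finite.iff_fg.2 (MvPolynomial.homogeneousSubmodule_fg _ _ k)
  have h2 : FiniteDimensional ℝ (MvPolynomial.homogeneousSubmodule (Fin d) ℝ k ⊓
      LinearMap.ker (laplacianPoly d) : Submodule ℝ _) :=
    Submodule.finiteDimensional_of_le inf_le_left
  unfold harmonics
  infer_instance

lemma IsHarmonicONB.sphInt_mul {k : ℕ} {φ : Fin (dimH d k) → C(Sph d, ℝ)}
    (hφ : IsHarmonicONB d k φ) (i j : Fin (dimH d k)) :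
    sphInt d (φ i * φ j) = if i = j then 1 else 0 := hφ.orthonormal i j

lemma IsHarmonicONB.sphInt_sum_mul {k : ℕ} {φ : Fin (dimH d k) → C(Sph d, ℝ)}
    (hφ : IsHarmonicONB d k φ) (c : Fin (dimH d k) → ℝ) (j : Fin (dimH d k)) :
    sphInt d ((∑ i, c i • φ i) * φ j) = c j := by
  simp [Finset.sum_mul, map_sum, hφ.sphInt_mul]

lemma IsHarmonicONB.eq_sum {k : ℕ} {φ : Fin (dimH d k) → C(Sph d, ℝ)}
    (hφ : IsHarmonicONB d k φ) {f : C(Sph d, ℝ)} (hf : f ∈ harmonics d k) :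
    f = ∑ i, sphInt d (f * φ i) • φ i := by
  have := finite_harmonics d k
  let ψ : Fin (dimH d k) → harmonics d k := fun i => ⟨φ i, hφ.mem i⟩
  have hli : LinearIndependent ℝ ψ := by
    rw [Fintype.linearIndependent_iff]
    intro c hc j
    have := congrArg (fun g : harmonics d k => sphInt d (g.1 * φ j)) hc
    simpa [ψ, hφ.sphInt_sum_mul] using this
  have hspan := hli.span_eq_top_of_card_eq_finrank' (by rw [Fintype.card_fin]; rfl)
  have hmem : (⟨f, hf⟩ : harmonics d k) ∈ Submodule.span ℝ (Set.range ψ) := by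
    rw [hspan]; trivial
  obtain ⟨c, hc⟩ := (Submodule.mem_span_range_iff_exists_fun ℝ).1 hmem
  have hc' : ∑ i, c i • φ i = f := by simpa [ψ] using congrArg Subtype.val hc
  have : ∀ i, sphInt d (f * φ i) = c i := fun i => by rw [← hc', hφ.sphInt_sum_mul]
  simp only [this, hc']

/-- Orthonormal bases of a finite-dimensional subspace for the inner product pulled back along an
injective linear map. -/
lemma exists_orthonormal_of_injective {V H : Type*} [AddCommGroup V] [Module ℝ V]
    [NormedAddCommGroup H] [InnerProductSpace ℝ H] (T : V →ₗ[ℝ] H) (hT : Function.Injective T)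
    (S : Submodule ℝ V) [FiniteDimensional ℝ S] :
    ∃ φ : Fin (Module.finrank ℝ S) → V, (∀ i, φ i ∈ S) ∧
      ∀ i j, ⟪T (φ i), T (φ j)⟫ = if i = j then (1 : ℝ) else 0 := by
  let e := Submodule.equivMapOfInjective T hT S
  let b := (stdOrthonormalBasis ℝ (S.map T)).reindex (finCongr e.finrank_eq.symm)
  refine ⟨fun i => (e.symm (b i)).1, fun i => (e.symm (b i)).2, fun i j => ?_⟩
  have hb : ∀ i, T (e.symm (b i)).1 = (b i : S.map T) := fun i =>
    congrArg Subtype.val (e.apply_symm_apply (b i))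
  rw [hb, hb]
  exact orthonormal_iff_ite.1 b.orthonormal i j

lemma exists_isHarmonicONB (d k : ℕ) : ∃ φ, IsHarmonicONB d k φ := by
  have := finite_harmonics d k
  obtain ⟨φ, hmem, horth⟩ := exists_orthonormal_of_injective
    (ContinuousMap.toLp (E := ℝ) 2 (surface d) ℝ).toLinearMap
    (ContinuousMap.toLp_injective (surface d)) (harmonics d k)
  refine ⟨φ, hmem, fun i j => (Eq.trans ?_ (ContinuousMap.inner_toLp _ (φ i) (φ j)).symm).trans
    (horth i j)⟩
  simp [mul_comm]

/-! ### Legendre polynomials and power expansions -/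

/-- The reproducing kernel `∑ i, φ_i(u) φ_i(v)` of a finite family of functions on the sphere. -/
noncomputable def kernelSum {n : ℕ} (φ : Fin n → C(Sph d, ℝ)) (u v : Sph d) : ℝ :=
  ∑ i, φ i u * φ i v

/-- Expansion of `⟨a, ω⟩ ^ m` in spherical harmonics. -/
lemma zonalPow_eq_sum (hd : 1 ≤ d) {Φ : (k : ℕ) → Fin (dimH d k) → C(Sph d, ℝ)}
    (hΦ : ∀ k, IsHarmonicONB d k (Φ k)) (a : Sph d) (m : ℕ) :
    zonalPow a m = ∑ k ∈ Finset.range (m + 1), zonalMoment d m k • ∑ i, Φ k i a • Φ k i := by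
  obtain ⟨h, hh⟩ := (Submodule.mem_iSup_finset_iff_exists_sum _ _).1 (zonalPow_mem_iSup hd a m)
  rw [← hh]
  refine Finset.sum_congr rfl fun k hk => ?_
  rw [(hΦ k).eq_sum (h k).2, Finset.smul_sum]
  refine Finset.sum_congr rfl fun i _ => ?_
  rw [smul_smul]
  congr 1
  rw [← sphInt_zonalPow_mul hd a m ((hΦ k).mem i), ← hh, Finset.sum_mul, map_sum]
  symm
  refine Finset.sum_eq_single k (fun l _ hl => ?_) (fun h => (h hk).elim)
  exact sphInt_mul_eq_zero hd hl (h l).2 ((hΦ k).mem i)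

lemma inner_pow_eq_sum (hd : 1 ≤ d) {Φ : (k : ℕ) → Fin (dimH d k) → C(Sph d, ℝ)}
    (hΦ : ∀ k, IsHarmonicONB d k (Φ k)) (a v : Sph d) (m : ℕ) :
    ⟪a.1, v.1⟫ ^ m =
      ∑ k ∈ Finset.range (m + 1), zonalMoment d m k * kernelSum (Φ k) a v := by
  rw [← zonalPow_apply, zonalPow_eq_sum hd hΦ a m]
  simp [kernelSum]

/-- The kernel of `H_k` is a polynomial of degree at most `k` in `⟨u, v⟩`: the diagonal coefficients
of the triangular system `inner_pow_eq_sum` are nonzero. -/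
lemma exists_kernel_polynomial (hd : 1 ≤ d) (k : ℕ) :
    ∃ Q : Polynomial ℝ, Q.natDegree ≤ k ∧
      ∀ Φ : (k : ℕ) → Fin (dimH d k) → C(Sph d, ℝ), (∀ k, IsHarmonicONB d k (Φ k)) →
        ∀ u v : Sph d, kernelSum (Φ k) u v = Q.eval ⟪u.1, v.1⟫ := by
  induction k using Nat.strong_induction_on with
  | _ k ih =>
    have ih' : ∀ j, ∃ Q : Polynomial ℝ, j < k → Q.natDegree ≤ j ∧
        ∀ Φ : (k : ℕ) → Fin (dimH d k) → C(Sph d, ℝ), (∀ k, IsHarmonicONB d k (Φ k)) →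
          ∀ u v : Sph d, kernelSum (Φ j) u v = Q.eval ⟪u.1, v.1⟫ := fun j => by
      by_cases hj : j < k
      · obtain ⟨Q, hQ⟩ := ih j hj
        exact ⟨Q, fun _ => hQ⟩
      · exact ⟨0, fun h => (hj h).elim⟩
    choose Q hQ using ih'
    have hμ := (zonalMoment_pos hd le_rfl rfl : 0 < zonalMoment d k k).ne'
    refine ⟨Polynomial.C (zonalMoment d k k)⁻¹ * (Polynomial.X ^ k -
      ∑ j ∈ Finset.range k, Polynomial.C (zonalMoment d k j) * Q j), ?_, fun Φ hΦ u v => ?_⟩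
    · refine (Polynomial.natDegree_C_mul_le _ _).trans
        ((Polynomial.natDegree_sub_le _ _).trans (max_le (by simp) ?_))
      refine Polynomial.natDegree_sum_le_of_forall_le _ _ fun j hj => ?_
      exact (Polynomial.natDegree_C_mul_le _ _).trans
        ((hQ j (Finset.mem_range.1 hj)).1.trans (Finset.mem_range.1 hj).le)
    · have h := inner_pow_eq_sum hd hΦ u v k
      rw [Finset.sum_range_succ] at h
      have h2 : ∑ j ∈ Finset.range k, zonalMoment d k j * kernelSum (Φ j) u v =
          ∑ j ∈ Finset.range k, zonalMoment d k j * (Q j).eval ⟪u.1, v.1⟫ :=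
        Finset.sum_congr rfl fun j hj => by
          rw [(hQ j (Finset.mem_range.1 hj)).2 Φ hΦ u v]
      rw [h2] at h
      simp only [Polynomial.eval_mul, Polynomial.eval_C, Polynomial.eval_sub, Polynomial.eval_pow,
        Polynomial.eval_X, Polynomial.eval_finsetSum, h]
      field_simp
      ring

lemma exists_inner_eq (hd : 2 ≤ d) {t : ℝ} (ht : t ∈ Set.Icc (-1 : ℝ) 1) :
    ∃ u v : Sph d, ⟪u.1, v.1⟫ = t := by
  have h0 : (⟨0, by omega⟩ : Fin d) ≠ ⟨1, by omega⟩ := by simp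
  have hs : 0 ≤ 1 - t ^ 2 := by nlinarith [ht.1, ht.2]
  let i : Fin d := ⟨0, by omega⟩
  let j : Fin d := ⟨1, by omega⟩
  have hij : i ≠ j := h0
  refine ⟨⟨EuclideanSpace.single i 1, by simp⟩,
    ⟨EuclideanSpace.single i t + EuclideanSpace.single j √(1 - t ^ 2), ?_⟩, ?_⟩
  · have : ‖EuclideanSpace.single i t + EuclideanSpace.single j √(1 - t ^ 2)‖ ^ 2 = 1 := by
      rw [@norm_add_sq_real]
      simp [EuclideanSpace.inner_single_left, hij, Real.sq_sqrt hs]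
    rw [mem_sphere_zero_iff_norm]
    exact (pow_eq_one_iff_of_nonneg (norm_nonneg _) two_ne_zero).1 this
  · simp [EuclideanSpace.inner_single_left, hij]

/-- Each `H_k` is nonzero: otherwise `t ^ k` would be a combination of kernels of lower degree. -/
lemma dimH_pos (hd : 2 ≤ d) (k : ℕ) : 0 < dimH d k := by
  by_contra hk
  have hk0 : dimH d k = 0 := by omega
  have hd1 : 1 ≤ d := by omega
  choose Φ hΦ using exists_isHarmonicONB d
  choose Q hdeg hQ using fun k => exists_kernel_polynomial hd1 k
  have hpoly : (Polynomial.X ^ k : Polynomial ℝ) =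
      ∑ j ∈ Finset.range k, Polynomial.C (zonalMoment d k j) * Q j := by
    refine Polynomial.eq_of_infinite_eval_eq _ _
      ((Set.Icc_infinite (by norm_num : (-1 : ℝ) < 1)).mono fun t ht => ?_)
    obtain ⟨u, v, rfl⟩ := exists_inner_eq hd ht
    have hker : kernelSum (Φ k) u v = 0 := by
      have : IsEmpty (Fin (dimH d k)) := by rw [hk0]; infer_instance
      simp [kernelSum]
    have h := inner_pow_eq_sum hd1 hΦ u v k
    rw [Finset.sum_range_succ, hker, mul_zero, add_zero] at h
    simp only [Set.mem_ofPred_eq, Polynomial.eval_pow, Polynomial.eval_X,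
      Polynomial.eval_finsetSum, Polynomial.eval_mul, Polynomial.eval_C, h]
    exact Finset.sum_congr rfl fun j _ => by rw [hQ j Φ hΦ u v]
  rcases Nat.eq_zero_or_pos k with rfl | hpos
  · simp at hpoly
  · have h1 : (∑ j ∈ Finset.range k, Polynomial.C (zonalMoment d k j) * Q j).natDegree ≤ k - 1 := by
      refine Polynomial.natDegree_sum_le_of_forall_le _ _ fun j hj => ?_
      exact (Polynomial.natDegree_C_mul_le _ _).trans ((hdeg j).trans
        (by have := Finset.mem_range.1 hj; omega))
    rw [← hpoly, Polynomial.natDegree_X_pow] at h1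
    omega

lemma isLegendre_legendreP (hd : 2 ≤ d) (k : ℕ) : IsLegendre d k (legendreP d k) := by
  refine Classical.epsilon_spec (p := IsLegendre d k) ?_
  have hd1 : 1 ≤ d := by omega
  obtain ⟨Q, -, hQ⟩ := exists_kernel_polynomial hd1 k
  choose Φ hΦ using exists_isHarmonicONB d
  refine ⟨Polynomial.C (area d / dimH d k) * Q, fun φ hφ u v => ?_⟩
  have h := hQ (Function.update Φ k φ) (fun l => by
    rcases eq_or_ne l k with rfl | hl
    · simpa using hφ
    · simpa [hl] using hΦ l) u v
  simp only [Function.update_self, kernelSum] at h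
  have h1 : (dimH d k : ℝ) ≠ 0 := by exact_mod_cast (dimH_pos hd k).ne'
  have h2 := (area_pos hd1).ne'
  rw [h, Polynomial.eval_mul, Polynomial.eval_C]
  field_simp

lemma kernelSum_eq_legendreP (hd : 2 ≤ d) {k : ℕ} {φ : Fin (dimH d k) → C(Sph d, ℝ)}
    (hφ : IsHarmonicONB d k φ) (u v : Sph d) :
    kernelSum φ u v = dimH d k / area d * (legendreP d k).eval ⟪u.1, v.1⟫ :=
  isLegendre_legendreP hd k φ hφ u v

lemma exists_isPowerExpansion (hd : 2 ≤ d) (m : ℕ) : ∃ c, IsPowerExpansion d m c := by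
  have hd1 : 1 ≤ d := by omega
  choose Φ hΦ using exists_isHarmonicONB d
  refine ⟨fun j => zonalMoment d m j * (dimH d j / area d), fun t ht => ?_⟩
  obtain ⟨u, v, rfl⟩ := exists_inner_eq hd ht
  rw [inner_pow_eq_sum hd1 hΦ, Finset.sum_range]
  exact Finset.sum_congr rfl fun j _ => by
    rw [kernelSum_eq_legendreP hd (hΦ j), mul_assoc]

lemma IsHarmonicONB.exists_ne_zero {k : ℕ} {φ : Fin (dimH d k) → C(Sph d, ℝ)}
    (hφ : IsHarmonicONB d k φ) (i : Fin (dimH d k)) : ∃ a, φ i a ≠ 0 := by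
  by_contra! h
  simpa [h] using hφ.orthonormal i i

/-- The coefficient of `P_k^d` in the expansion of `t ^ m` is the Funk–Hecke constant, up to
normalization. -/
lemma legendreCoeff_div_dimH (hd : 2 ≤ d) {m k : ℕ} (hkm : k ≤ m) :
    legendreCoeff d m k / dimH d k = zonalMoment d m k / area d := by
  have hd1 : 1 ≤ d := by omega
  have harea := (area_pos hd1).ne'
  have hdim : ∀ j, (dimH d j : ℝ) ≠ 0 := fun j => by exact_mod_cast (dimH_pos hd j).ne'
  choose Φ hΦ using exists_isHarmonicONB d
  have hc := Classical.epsilon_spec (exists_isPowerExpansion hd m)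
  set c := Classical.epsilon (IsPowerExpansion d m) with hcdef
  have hk : legendreCoeff d m k = c ⟨k, by omega⟩ := by
    rw [legendreCoeff, dif_pos (by omega)]
  rw [hk]
  -- Both expansions of `⟨a, ω⟩ ^ m` are tested against one basis function that is nonzero at `a`.
  let i : Fin (dimH d k) := ⟨0, dimH_pos hd k⟩
  obtain ⟨a, ha⟩ := (hΦ k).exists_ne_zero i
  have hz : zonalPow a m =
      ∑ j : Fin (m + 1), (c j * (area d / dimH d j)) • ∑ i, Φ j i a • Φ j i := by
    ext v
    have habs := abs_real_inner_le_norm a.1 v.1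
    rw [norm_eq_of_mem_sphere, norm_eq_of_mem_sphere, one_mul] at habs
    rw [zonalPow_apply, hc _ (abs_le.1 habs), ContinuousMap.sum_apply]
    refine Finset.sum_congr rfl fun j _ => ?_
    have := kernelSum_eq_legendreP hd (hΦ j) a v
    simp only [ContinuousMap.smul_apply, ContinuousMap.sum_apply, smul_eq_mul]
    rw [← kernelSum, this]
    have := hdim j
    field_simp
  have h := sphInt_zonalPow_mul hd1 a m ((hΦ k).mem i)
  rw [hz, Finset.sum_mul, map_sum, Finset.sum_eq_single (⟨k, by omega⟩ : Fin (m + 1))] at h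
  · rw [smul_mul_assoc, map_smul, (hΦ k).sphInt_sum_mul, smul_eq_mul] at h
    have h' := mul_right_cancel₀ ha h
    rw [← h']
    have := hdim k
    simp only
    field_simp
  · intro j _ hj
    have hjk : (j : ℕ) ≠ k := fun h => hj (Fin.ext h)
    rw [smul_mul_assoc, map_smul, Finset.sum_mul, map_sum]
    simp [sphInt_mul_eq_zero hd1 hjk ((hΦ j).mem _) ((hΦ k).mem i)]
  · simp

lemma sqrt_eigenval (hd : 2 ≤ d) {β k : ℕ} (hk : k ∈ orders β) :
    √(eigenval d β k) = zonalMoment d β k / area d := by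
  have hd1 : 1 ≤ d := by omega
  simp only [orders, Finset.mem_filter, Finset.mem_Icc] at hk
  rw [eigenval, if_pos (by omega), legendreCoeff_div_dimH hd (by omega)]
  exact Real.sqrt_sq (div_pos (zonalMoment_pos hd1 (by omega) hk.2) (area_pos hd1)).le

/-! ### The covariance kernel -/

lemma psi_add_two (hd : 1 ≤ d) (m : ℕ) : (d + m) * psi d (m + 2) = (m + 1) * psi d m := by
  have hd' : (1 : ℝ) ≤ d := by exact_mod_cast hd
  by_cases hm : Even m
  · have hm2 : Even (m + 2) := hm.add even_two
    rw [psi, psi, if_pos hm, if_pos hm2]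
    have e1 : (((m + 2 : ℕ) : ℝ) + 1) / 2 = (m + 1) / 2 + 1 := by push_cast; ring
    have e2 : (((m + 2 : ℕ) : ℝ) + d) / 2 = (m + d) / 2 + 1 := by push_cast; ring
    have p1 : (0 : ℝ) < (m + 1) / 2 := by positivity
    have p2 : (0 : ℝ) < (m + d) / 2 := by positivity
    rw [e1, e2, Real.Gamma_add_one p1.ne', Real.Gamma_add_one p2.ne']
    have := (Real.Gamma_pos_of_pos p2).ne'
    have : √Real.pi ≠ 0 := by positivity
    field_simp
    ring
  · have hm2 : ¬ Even (m + 2) := by simpa [Nat.even_add] using hm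
    simp [psi, hm, hm2]

lemma zonalMoment_zero_right (hd : 1 ≤ d) (m : ℕ) : zonalMoment d m 0 = area d * psi d m := by
  have hd' : (1 : ℝ) ≤ d := by exact_mod_cast hd
  induction m using Nat.twoStepInduction with
  | zero =>
    have h := (radial_pos d 0).ne'
    have h2 : Real.Gamma ((d : ℝ) / 2) ≠ 0 := (Real.Gamma_pos_of_pos (by positivity)).ne'
    have h3 : √Real.pi ≠ 0 := by positivity
    simp only [zonalMoment, gaussFactor_zero, psi, Nat.cast_zero, zero_add, if_true, Even.zero,
      Real.Gamma_one_half_eq, if_true]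
    field_simp
  | one => simp [zonalMoment_eq_zero, psi]
  | more m ih _ =>
    have h1 := zonalMoment_add_two_zero hd m
    have h2 := psi_add_two hd m
    have h : (d + m : ℝ) ≠ 0 := by positivity
    refine mul_left_cancel₀ h ?_
    rw [h1, ih, mul_left_comm, ← h2]
    ring

lemma eta_eq_sum (hd : 1 ≤ d) {Φ : (k : ℕ) → Fin (dimH d k) → C(Sph d, ℝ)}
    (hΦ : ∀ k, IsHarmonicONB d k (Φ k)) (β : ℕ) (b c : Sph d) :
    eta d β b c = (area d)⁻¹ *
      ∑ k ∈ Finset.range (β + 1), zonalMoment d β k ^ 2 * kernelSum (Φ k) b c := by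
  have h1 : eta d β b c = (area d)⁻¹ * sphInt d (zonalPow b β * zonalPow c β) := by
    rw [eta, uniformSphere, integral_smul_measure, sphInt_apply, area, measureReal_def,
      ENNReal.toReal_inv, smul_eq_mul]
    simp only [ContinuousMap.mul_apply, zonalPow_apply]
  rw [h1, zonalPow_eq_sum hd hΦ c β, Finset.mul_sum, map_sum]
  congr 1
  refine Finset.sum_congr rfl fun k _ => ?_
  rw [mul_smul_comm, map_smul, Finset.mul_sum, map_sum, smul_eq_mul, pow_two, mul_assoc, kernelSum,
    Finset.mul_sum (a := zonalMoment d β k) (f := fun i => Φ k i b * Φ k i c)]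
  congr 1
  refine Finset.sum_congr rfl fun i _ => ?_
  rw [mul_smul_comm, map_smul, sphInt_zonalPow_mul hd b β ((hΦ k).mem i), smul_eq_mul]
  ring

/-- The functions `f_{k,j} = √|S^{d-1}| √λ_k φ_{k,j}` whose tensor squares sum to the covariance
kernel. -/
noncomputable def loading (d β : ℕ) (φ : (k : ℕ) → Fin (dimH d k) → C(Sph d, ℝ))
    (i : ArrayIndex d β) (b : Sph d) : ℝ :=
  Real.sqrt (area d) * (Real.sqrt (eigenval d β i.1) * φ i.1 i.2 b)

lemma expansion_eq_sum_loading (d β : ℕ) (φ : (k : ℕ) → Fin (dimH d k) → C(Sph d, ℝ))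
    (x : ArrayIndex d β → ℝ) (b : Sph d) :
    expansion d β φ x b = ∑ i, loading d β φ i b * x i := by
  simp only [expansion, loading, Fintype.sum_sigma, Finset.mul_sum, mul_assoc]

/-- Finite-rank factorization of the covariance kernel. -/
lemma rho_eq_sum_loading (hd : 2 ≤ d) {β : ℕ} {φ : (k : ℕ) → Fin (dimH d k) → C(Sph d, ℝ)}
    (hφ : ∀ k ∈ orders β, IsHarmonicONB d k (φ k)) (b c : Sph d) :
    rho d β b c = ∑ i, loading d β φ i b * loading d β φ i c := by
  classical
  have hd1 : 1 ≤ d := by omega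
  have harea := area_pos hd1
  choose Φ₀ hΦ₀ using exists_isHarmonicONB d
  -- The given bases, completed by arbitrary ones in the remaining orders, whose terms vanish for
  -- `k ≥ 1` by parity.
  let Φ : (k : ℕ) → Fin (dimH d k) → C(Sph d, ℝ) := fun k => if k ∈ orders β then φ k else Φ₀ k
  have hΦ : ∀ k, IsHarmonicONB d k (Φ k) := fun k => by
    by_cases hk : k ∈ orders β
    · simpa [Φ, hk] using hφ k hk
    · simpa [Φ, hk] using hΦ₀ k
  have h0 : zonalMoment d 0 0 * kernelSum (Φ 0) b c = 1 := by
    simpa using (inner_pow_eq_sum hd1 hΦ b c 0).symm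
  have h00 : zonalMoment d 0 0 = area d := by
    have h := sphInt_zonalPow hd1 b 0
    have : zonalPow b 0 = 1 := by ext; simp [zonalPow_apply]
    rw [← h, this, sphInt_one]
  rw [h00] at h0
  have hRHS : ∑ i, loading d β φ i b * loading d β φ i c =
      (area d)⁻¹ * ∑ k ∈ orders β, zonalMoment d β k ^ 2 * kernelSum (Φ k) b c := by
    rw [Fintype.sum_sigma, ← Finset.sum_coe_sort (orders β), Finset.mul_sum]
    refine Finset.sum_congr rfl fun k _ => ?_
    have hk : Φ k = φ k := by simp [Φ]
    rw [hk, kernelSum, Finset.mul_sum, Finset.mul_sum]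
    refine Finset.sum_congr rfl fun j _ => ?_
    simp only [loading, sqrt_eigenval hd k.2]
    have hs := Real.mul_self_sqrt harea.le
    calc _ = (√(area d) * √(area d)) * ((zonalMoment d β k / area d) ^ 2 *
          (φ k j b * φ k j c)) := by ring
      _ = _ := by
        rw [hs]
        field_simp
  have hsub : insert 0 (orders β) ⊆ Finset.range (β + 1) := by
    intro k hk
    simp only [orders, Finset.mem_insert, Finset.mem_filter, Finset.mem_Icc, Finset.mem_range]
      at hk ⊢
    omega
  rw [rho, eta_eq_sum hd1 hΦ, hRHS, ← Finset.sum_subset hsub, Finset.sum_insert (by simp [orders]),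
    zonalMoment_zero_right hd1, mul_add, add_sub_assoc]
  · have : (area d)⁻¹ * ((area d * psi d β) ^ 2 * kernelSum (Φ 0) b c) = psi d β ^ 2 := by
      have h : kernelSum (Φ 0) b c = (area d)⁻¹ := eq_inv_of_mul_eq_one_right h0
      rw [h]
      field_simp
    rw [this]
    ring
  · intro k hk hk'
    have : k % 2 ≠ β % 2 := by
      simp only [orders, Finset.mem_insert, Finset.mem_filter, Finset.mem_Icc, Finset.mem_range]
        at hk hk'
      omega
    simp [zonalMoment_eq_zero this]

/-- The functions `f_{k,j}` are linearly independent. -/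
lemma loading_linearIndependent (hd : 2 ≤ d) {β : ℕ}
    {φ : (k : ℕ) → Fin (dimH d k) → C(Sph d, ℝ)}
    (hφ : ∀ k ∈ orders β, IsHarmonicONB d k (φ k)) :
    LinearIndependent ℝ (loading d β φ) := by
  have hd1 : 1 ≤ d := by omega
  rw [Fintype.linearIndependent_iff]
  rintro g hg ⟨k, j⟩
  have hpos : ∀ k : orders β, 0 < √(area d) * √(eigenval d β k) := fun k => by
    have hk := k.2
    rw [sqrt_eigenval hd hk]
    simp only [orders, Finset.mem_filter, Finset.mem_Icc] at hk
    exact mul_pos (Real.sqrt_pos.2 (area_pos hd1))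
      (div_pos (zonalMoment_pos hd1 hk.1.2 hk.2) (area_pos hd1))
  have hg' : ∑ k : orders β, ∑ j, (g ⟨k, j⟩ * (√(area d) * √(eigenval d β k))) • φ k j = 0 := by
    ext b
    have := congrFun hg b
    rw [Fintype.sum_sigma] at this
    simpa [loading, mul_assoc] using this
  have h := congrArg (fun f => sphInt d (f * φ k j)) hg'
  simp only [Finset.sum_mul, map_sum, zero_mul, map_zero, smul_mul_assoc, map_smul] at h
  rw [Finset.sum_eq_single k] at h
  · simp only [(hφ k k.2).sphInt_mul, smul_eq_mul, mul_ite, mul_one, mul_zero,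
      Finset.sum_ite_eq', Finset.mem_univ, if_true] at h
    exact (mul_eq_zero.1 h).resolve_right (hpos k).ne'
  · intro l _ hl
    have hlk : (l : ℕ) ≠ k := fun h => hl (Subtype.ext h)
    simp [sphInt_mul_eq_zero hd1 hlk ((hφ l l.2).mem _) ((hφ k k.2).mem j)]
  · simp

/-! ### Gaussian processes with finite-rank covariance -/

/-- A linearly independent finite family of functions admits a biorthogonal family of finitely
supported functionals. -/
lemma exists_biorthogonal {T ι : Type*} [Fintype ι] [DecidableEq ι] {f : ι → T → ℝ}
    (hf : LinearIndependent ℝ f) :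
    ∃ (I : Finset T) (A : ι → T → ℝ), ∀ i j, ∑ x ∈ I, A i x * f j x = if i = j then 1 else 0 := by
  classical
  have hspan : Submodule.span ℝ (Set.range fun x i => f i x) = ⊤ := by
    by_contra hne
    obtain ⟨g, hg0, hg⟩ := Submodule.exists_le_ker_of_lt_top _ (lt_top_iff_ne_top.2 hne)
    have hgsum : ∀ y : ι → ℝ, g y = ∑ i, y i * g (Pi.single i 1) := fun y => by
      conv_lhs => rw [pi_eq_sum_univ' y]
      simp [map_sum]
    have h0 : ∑ i, g (Pi.single i 1) • f i = 0 := by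
      ext x
      have : g (fun i => f i x) = 0 := hg (Submodule.subset_span ⟨x, rfl⟩)
      rw [hgsum] at this
      simpa [mul_comm] using this
    have h1 := Fintype.linearIndependent_iff.1 hf _ h0
    exact hg0 (LinearMap.ext fun y => by rw [hgsum]; simp [h1])
  have hmem : ∀ i : ι, ∃ c : T →₀ ℝ, (c.sum fun x a => a • fun i => f i x) = Pi.single i 1 :=
    fun i => (Finsupp.mem_span_range_iff_exists_finsupp).1 (by rw [hspan]; trivial)
  choose c hc using hmem
  refine ⟨Finset.univ.biUnion fun i => (c i).support, fun i x => c i x, fun i j => ?_⟩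
  have h := congrFun (hc i) j
  rw [Finsupp.sum_of_support_subset (s := Finset.univ.biUnion fun i => (c i).support) _
    (Finset.subset_biUnion_of_mem (fun i => (c i).support) (Finset.mem_univ i)) _ (by simp)] at h
  simpa [Pi.single_apply, eq_comm] using h

section Processes

variable {T ι Ω : Type*} [MeasurableSpace Ω] {P : Measure Ω}

lemma IsStdNormalArray.hasGaussianLaw_eval {N : ι → Ω → ℝ} (hN : IsStdNormalArray N P) (i : ι) :
    HasGaussianLaw (N i) P where
  isGaussian_map := by
    rw [hN.law i]
    infer_instance

lemma IsStdNormalArray.hasGaussianLaw [Fintype ι] {N : ι → Ω → ℝ} (hN : IsStdNormalArray N P) :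
    HasGaussianLaw (fun ω i => N i ω) P :=
  hN.indep.hasGaussianLaw hN.hasGaussianLaw_eval

lemma IsStdNormalArray.integral_eq_zero {N : ι → Ω → ℝ} (hN : IsStdNormalArray N P) (i : ι) :
    ∫ ω, N i ω ∂P = 0 := by
  have h := integral_map (μ := P) (hN.measurable i).aemeasurable (f := fun x : ℝ => x)
    (by fun_prop)
  rw [← h, hN.law i, integral_id_gaussianReal]

lemma IsStdNormalArray.covariance [DecidableEq ι] {N : ι → Ω → ℝ}
    (hN : IsStdNormalArray N P) (i j : ι) :
    cov[N i, N j; P] = if i = j then 1 else 0 := by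
  split_ifs with h
  · subst h
    rw [covariance_self (hN.measurable i).aemeasurable]
    have h := variance_map (μ := P) (X := fun x : ℝ => x) (Y := N i) (by fun_prop)
      (hN.measurable i).aemeasurable
    rw [hN.law i, variance_fun_id_gaussianReal] at h
    simpa [Function.comp_def] using h.symm
  · exact (hN.indep.indepFun h).covariance_eq_zero (hN.hasGaussianLaw_eval i).memLp_two
      (hN.hasGaussianLaw_eval j).memLp_two

/-- Finite sums `∑ i, f i t * N i` of independent standard normal variables form a Gaussian
process. -/
lemma IsStdNormalArray.isGaussianProcess_sum [Fintype ι] {N : ι → Ω → ℝ} (hN : IsStdNormalArray N P)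
    (f : ι → T → ℝ) : IsGaussianProcess (fun t ω => ∑ i, f i t * N i ω) P where
  hasGaussianLaw I := by
    have h := hN.hasGaussianLaw.map_fun (F := I → ℝ) (ContinuousLinearMap.pi fun t : I =>
      ∑ i, f i t • ContinuousLinearMap.proj (R := ℝ) (φ := fun _ : ι => ℝ) i)
    exact h.congr (Filter.Eventually.of_forall fun ω => by ext t; simp)

lemma IsStdNormalArray.covariance_sum [Fintype ι] {N : ι → Ω → ℝ} (hN : IsStdNormalArray N P)
    (f g : ι → ℝ) :
    cov[fun ω => ∑ i, f i * N i ω, fun ω => ∑ i, g i * N i ω; P] = ∑ i, f i * g i := by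
  classical
  have := hN.indep.isProbabilityMeasure
  rw [covariance_fun_sum_fun_sum
    (fun i => (hN.hasGaussianLaw_eval i).memLp_two.const_mul (f i))
    (fun i => (hN.hasGaussianLaw_eval i).memLp_two.const_mul (g i))]
  simp only [covariance_const_mul_left, covariance_const_mul_right, hN.covariance]
  simp [mul_comm]

lemma IsStdNormalArray.map_eq_pi [Fintype ι] {N : ι → Ω → ℝ} (hN : IsStdNormalArray N P) :
    P.map (fun ω i => N i ω) = Measure.pi fun _ => gaussianReal 0 1 := by
  have := hN.indep.isProbabilityMeasure
  rw [(iIndepFun_iff_map_fun_eq_pi_map fun i => (hN.measurable i).aemeasurable).1 hN.indep]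
  simp only [hN.law]

/-- A centred Gaussian process with covariance `∑ i, f i s * f i t`, for a finite linearly
independent family `f`, equals `∑ i, f i t * N i` for independent standard normal variables `N i`.
These are finite linear combinations of values of the process. -/
lemma exists_isStdNormalArray_of_covariance_eq_sum [Fintype ι] [IsProbabilityMeasure P]
    {f : ι → T → ℝ} (hf : LinearIndependent ℝ f) {Z : T → Ω → ℝ} (hmeas : ∀ t, Measurable (Z t))
    (hZ : IsGaussianProcess Z P) (hmean : ∀ t, ∫ ω, Z t ω ∂P = 0)
    (hcov : ∀ s t, cov[Z s, Z t; P] = ∑ i, f i s * f i t) :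
    ∃ N : ι → Ω → ℝ, IsStdNormalArray N P ∧ ∀ t, ∀ᵐ ω ∂P, Z t ω = ∑ i, f i t * N i ω := by
  classical
  obtain ⟨I, A, hA⟩ := exists_biorthogonal hf
  let N : ι → Ω → ℝ := fun i ω => ∑ x ∈ I, A i x * Z x ω
  have hL2 : ∀ t, MemLp (Z t) 2 P := fun t => (hZ.hasGaussianLaw_eval t).memLp_two
  have hmeasN : ∀ i, Measurable (N i) := fun i =>
    Finset.measurable_sum _ fun x _ => (hmeas x).const_mul _
  have hgauss : HasGaussianLaw (fun ω i => N i ω) P := by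
    have h := (hZ.hasGaussianLaw I).map_fun (F := ι → ℝ) (ContinuousLinearMap.pi fun i =>
      ∑ x : I, A i x • ContinuousLinearMap.proj (R := ℝ) (φ := fun _ : I => ℝ) x)
    exact h.congr (Filter.Eventually.of_forall fun ω => by
      ext i
      simp [N, ← Finset.sum_coe_sort I])
  have hgi : ∀ i, HasGaussianLaw (N i) P := fun i => hgauss.eval i
  have hNL2 : ∀ i, MemLp (N i) 2 P := fun i => (hgi i).memLp_two
  have hmeanN : ∀ i, ∫ ω, N i ω ∂P = 0 := fun i => by
    rw [integral_finsetSum _ fun x _ => ((hL2 x).integrable one_le_two).const_mul _]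
    simp [integral_const_mul, hmean]
  have hcovZN : ∀ t i, cov[Z t, N i; P] = f i t := fun t i => by
    rw [covariance_fun_sum_right' (fun x _ => (hL2 x).const_mul _) (hL2 t)]
    simp only [covariance_const_mul_right, hcov, Finset.mul_sum]
    rw [Finset.sum_comm]
    have : ∀ j, ∑ x ∈ I, A i x * (f j t * f j x) = f j t * if i = j then 1 else 0 := fun j => by
      rw [← hA i j, Finset.mul_sum]
      exact Finset.sum_congr rfl fun x _ => by ring
    simp [this]
  have hcovN : ∀ i j, cov[N i, N j; P] = if i = j then 1 else 0 := fun i j => by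
    rw [covariance_fun_sum_left' (fun x _ => (hL2 x).const_mul _) (hNL2 j)]
    simp only [covariance_const_mul_left, hcovZN, hA]
  have hN : IsStdNormalArray N P :=
    { measurable := hmeasN
      law := fun i => by
        rw [(hgi i).map_eq_gaussianReal, hmeanN, ← covariance_self (hmeasN i).aemeasurable,
          hcovN, if_pos rfl, Real.toNNReal_one]
      indep := hgauss.iIndepFun_of_covariance_eq_zero fun i j hij => by
        rw [hcovN, if_neg hij] }
  refine ⟨N, hN, fun t => ?_⟩
  have hSL2 : MemLp (fun ω => ∑ i, f i t * N i ω) 2 P :=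
    memLp_finsetSum _ fun i _ => (hNL2 i).const_mul _
  -- The residual is centred with zero variance.
  have hDL2 : MemLp (fun ω => Z t ω - ∑ i, f i t * N i ω) 2 P := (hL2 t).sub hSL2
  have hvar : Var[fun ω => Z t ω - ∑ i, f i t * N i ω; P] = 0 := by
    have hcross : cov[Z t, fun ω => ∑ i, f i t * N i ω; P] = ∑ i, f i t * f i t := by
      rw [covariance_fun_sum_right (fun i => (hNL2 i).const_mul _) (hL2 t)]
      simp only [covariance_const_mul_right, hcovZN]
    rw [← covariance_self hDL2.aemeasurable,
      covariance_fun_sub_fun_sub (hL2 t) hSL2 (hL2 t) hSL2,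
      covariance_comm (fun ω => ∑ i, f i t * N i ω) (Z t), hcross, hcov, hN.covariance_sum]
    ring
  have hmean0 : ∫ ω, (Z t ω - ∑ i, f i t * N i ω) ∂P = 0 := by
    rw [integral_sub ((hL2 t).integrable one_le_two) (hSL2.integrable one_le_two), hmean,
      integral_finsetSum _ fun i _ => ((hNL2 i).integrable one_le_two).const_mul _]
    simp [integral_const_mul, hmeanN]
  filter_upwards [ae_eq_integral_of_variance_eq_zero hDL2 hvar] with ω hω
  exact sub_eq_zero.1 (hω.trans hmean0)

end Processes

/-! ### Representation of the limiting process -/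

lemma continuous_expansion (d β : ℕ) (φ : (k : ℕ) → Fin (dimH d k) → C(Sph d, ℝ))
    (x : ArrayIndex d β → ℝ) : Continuous (expansion d β φ x) := by
  unfold expansion
  fun_prop

lemma measurable_expansion (d β : ℕ) (φ : (k : ℕ) → Fin (dimH d k) → C(Sph d, ℝ)) :
    Measurable (expansion d β φ) := by
  refine measurable_pi_lambda _ fun b => ?_
  simp only [expansion_eq_sum_loading]
  fun_prop

/-- The pathwise representation of a limiting process. -/
lemma IsLimitProcess.exists_expansion {d β : ℕ} (hd : 2 ≤ d)
    {φ : (k : ℕ) → Fin (dimH d k) → C(Sph d, ℝ)}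
    (hφ : ∀ k ∈ orders β, IsHarmonicONB d k (φ k))
    {Ω : Type*} [MeasurableSpace Ω] {P : Measure Ω} [IsProbabilityMeasure P] {Z : Sph d → Ω → ℝ}
    (hZ : IsLimitProcess d β Z P) :
    ∃ N : ArrayIndex d β → Ω → ℝ, IsStdNormalArray N P ∧
      ∀ᵐ ω ∂P, ∀ b : Sph d, Z b ω = expansion d β φ (fun i => N i ω) b := by
  obtain ⟨N, hN, hZN⟩ := exists_isStdNormalArray_of_covariance_eq_sum
    (loading_linearIndependent hd hφ) hZ.measurable hZ.gaussian hZ.centred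
    (fun b c => (hZ.covariance b c).trans (rho_eq_sum_loading hd hφ b c))
  refine ⟨N, hN, ?_⟩
  -- The exceptional null sets are collected over a countable dense set of points.
  obtain ⟨S, hS, hSd⟩ := TopologicalSpace.exists_countable_dense (Sph d)
  have hall : ∀ᵐ ω ∂P, ∀ b ∈ S, Z b ω = ∑ i, loading d β φ i b * N i ω :=
    (ae_ball_iff hS).2 fun b _ => hZN b
  filter_upwards [hall] with ω hω
  refine congrFun (Continuous.ext_on hSd (hZ.continuous_paths ω)
    (continuous_expansion d β φ _) fun b hb => ?_)
  rw [expansion_eq_sum_loading]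
  exact hω b hb

lemma IsStdNormalArray.isLimitProcess_expansion {d β : ℕ} (hd : 2 ≤ d)
    {φ : (k : ℕ) → Fin (dimH d k) → C(Sph d, ℝ)}
    (hφ : ∀ k ∈ orders β, IsHarmonicONB d k (φ k))
    {Ω : Type*} [MeasurableSpace Ω] {P : Measure Ω} {N : ArrayIndex d β → Ω → ℝ}
    (hN : IsStdNormalArray N P) :
    IsLimitProcess d β (fun b ω => expansion d β φ (fun i => N i ω) b) P where
  measurable b := by
    have := hN.measurable
    simp only [expansion_eq_sum_loading]
    fun_prop
  gaussian := by
    simp only [expansion_eq_sum_loading]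
    exact hN.isGaussianProcess_sum _
  centred b := by
    simp only [expansion_eq_sum_loading]
    rw [integral_finsetSum _ fun i _ => (hN.hasGaussianLaw_eval i).integrable.const_mul _]
    simp [integral_const_mul, hN.integral_eq_zero]
  covariance b c := by
    simp only [expansion_eq_sum_loading]
    rw [hN.covariance_sum, rho_eq_sum_loading hd hφ]
  continuous_paths ω := continuous_expansion d β φ _

end SphereProj

open SphereProj
theorem mainTheorem6 (d β : ℕ) (hd : 2 ≤ d) (hβ : 1 ≤ β)
    (φ : (k : ℕ) → Fin (dimH d k) → C(Sph d, ℝ))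
    (hφ : ∀ k ∈ orders β, IsHarmonicONB d k (φ k)) :
    -- Pathwise representation of any version of the limiting process.
    (∀ (Ω : Type*) [MeasurableSpace Ω] (P : Measure Ω) [IsProbabilityMeasure P]
      (Z : Sph d → Ω → ℝ), IsLimitProcess d β Z P →
      ∃ N : ArrayIndex d β → Ω → ℝ, IsStdNormalArray N P ∧
        ∀ᵐ ω ∂P, ∀ b : Sph d, Z b ω = expansion d β φ (fun i => N i ω) b) ∧
    -- Any array of independent standard normal variables yields the limiting process in law.
    (∀ (Ω' : Type*) [MeasurableSpace Ω'] (P' : Measure Ω') [IsProbabilityMeasure P']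
      (N : ArrayIndex d β → Ω' → ℝ), IsStdNormalArray N P' →
      IsLimitProcess d β (fun b ω => expansion d β φ (fun i => N i ω) b) P' ∧
      ∀ (Ω : Type*) [MeasurableSpace Ω] (P : Measure Ω) [IsProbabilityMeasure P]
        (Z : Sph d → Ω → ℝ), IsLimitProcess d β Z P →
        IdentDistrib (fun ω b => Z b ω)
          (fun ω b => expansion d β φ (fun i => N i ω) b) P P') := by
  refine ⟨fun Ω _ P _ Z hZ => hZ.exists_expansion hd hφ,
    fun Ω' _ P' _ N hN => ⟨hN.isLimitProcess_expansion hd hφ, fun Ω _ P _ Z hZ => ?_⟩⟩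
  obtain ⟨N', hN', hZN'⟩ := hZ.exists_expansion hd hφ
  have hid : IdentDistrib (fun ω i => N' i ω) (fun ω i => N i ω) P P' :=
    { aemeasurable_fst := (measurable_pi_lambda _ hN'.measurable).aemeasurable
      aemeasurable_snd := (measurable_pi_lambda _ hN.measurable).aemeasurable
      map_eq := by rw [hN'.map_eq_pi, hN.map_eq_pi] }
  have hZae : (fun ω b => Z b ω) =ᵐ[P] fun ω => expansion d β φ (fun i => N' i ω) :=
    hZN'.mono fun ω hω => funext hω
  exact (IdentDistrib.of_ae_eq (measurable_pi_lambda _ hZ.measurable).aemeasurable hZae).trans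
    (hid.comp (measurable_expansion d β φ))
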